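/- Let $X$ be a topological space. Sheaves are sheaves of abelian groups, complexes are unbounded cochain complexes, and $D(X)$, $D(\mathbb Z)$ are the unbounded derived categories of sheaves on $X$ and of abelian groups. Let $\pi^{-1}$ denote the exact functor sending an abelian group $G$ to the constant sheaf $G$ on $X$, and also the induced functor $\pi^{-1}\colon D(\mathbb Z)\to D(X)$. A space $Y$ is cohomologically trivial if $H^i(Y,G)=0$ for all $i>0$ and all abelian groups $G$; $X$ is locally cohomologically trivial if its cohomologically trivial open subsets form a basis of its topology. For $U\subseteq X$ open, $\mathbb Z_U$ is the extension by zero to $X$ of the constant sheaf $\mathbb Z$ on $U$. When the left adjoints exist, write $L(X,-)$ (cosections) for the left adjoint of $\pi^{-1}$ from abelian groups to sheaves, applied degreewise to complexes, and $\mathbb L(X,-)$ for the left adjoint of $\pi^{-1}\colon D(\mathbb Z)\to D(X)$. For a complex of sheaves $F$, the unit $F\to\pi^{-1}L(X,F)$ induces by adjunction a natural morphism $\alpha_F\colon\mathbb L(X,F)\to L(X,F)$ in $D(\mathbb Z)$; $F$ is called $L$-acyclic if $\alpha_F$ is an isomorphism. Theorem. Assume that $X$ is locally connected and locally cohomologically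 trivial. Then $L(X,-)$ and $\mathbb L(X,-)$ exist, and there are an endofunctor $F\mapsto C_\bullet F$ of the category of complexes of sheaves on $X$ and a natural transformation $p_F\colon C_\bullet F\to F$ such that, for every complex of sheaves $F$: 1. $p_F$ is a quasi-isomorphism; 2. $C_\bullet F$ is $L$-acyclic; 3. each term of $C_\bullet F$ is isomorphic to a direct sum of sheaves $\mathbb Z_U$ with $U$ non-empty, connected, open and cohomologically trivial (repetitions allowed); 4. there is an isomorphism $e_F\colon\mathbb L(X,F)\simeq L(X,C_\bullet F)$ in $D(\mathbb Z)$, natural in the complex $F$, such that $e_F\circ\mathbb L(X,p_F)=\alpha_{C_\bullet F}$. Moreover $\mathbb L(X,-)$, together with $\alpha$, is the (total) left derived functor of $L(X,-)$: it is the right Kan extension, along the localization functor from complexes of sheaves to $D(X)$, of the composite of $L(X,-)$ on complexes with the localization functor to $D(\mathbb Z)$. -/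

import Mathlib

open CategoryTheory CategoryTheory.Limits TopologicalSpace

universe w w' u

noncomputable section

namespace SheafHomology

/-- Sheaves of abelian groups on a topological space. -/
abbrev AbSheaf (X : TopCat.{u}) : Type (u + 1) :=
  CategoryTheory.Sheaf (Opens.grothendieckTopology X) AddCommGrpCat.{u}

/-- The inverse image functor along the projection of `X` to a point: an abelian group `G` is
sent to the constant sheaf `G` on `X`, the sheafification of the constant presheaf. -/
abbrev piInv (X : TopCat.{u}) : AddCommGrpCat.{u} ⥤ AbSheaf X :=
  constantSheaf (Opens.grothendieckTopology X) AddCommGrpCat.{u}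

/-- The constant sheaf functor is left exact. -/
instance piInv_preservesFiniteLimits (X : TopCat.{u}) : PreservesFiniteLimits (piInv X) := by
  have h : PreservesFiniteLimits (Functor.const (Opens X)ᵒᵖ (C := AddCommGrpCat.{u})) :=
    ⟨fun J _ _ => inferInstance⟩
  exact comp_preservesFiniteLimits _ _

/-- The constant sheaf functor is right exact (it is a left adjoint of global sections). -/
instance piInv_preservesFiniteColimits (X : TopCat.{u}) : PreservesFiniteColimits (piInv X) := by
  have h : PreservesColimitsOfSize.{0, 0} (piInv X) := (constantSheafAdj (Opens.grothendieckTopology X) AddCommGrpCat.{u}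
    (isTerminalTop (α := Opens X))).leftAdjoint_preservesColimits
  exact ⟨fun J _ _ => inferInstance⟩

/-- Sheaves of abelian groups have all small direct sums. -/
instance abSheaf_hasCoproducts (X : TopCat.{u}) (ι : Type u) :
    HasColimitsOfShape (Discrete ι) (AbSheaf X) :=
  (IsGrothendieckAbelian.hasColimits.{u} (AbSheaf X)).has_colimits_of_shape (Discrete ι)

/-- A space is cohomologically trivial if its sheaf cohomology in positive degrees with
coefficients in every abelian group vanishes. -/
def CohTrivial (X : TopCat.{u}) : Prop :=
  ∀ (i : ℕ), 0 < i → ∀ G : AddCommGrpCat.{u},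
    Subsingleton (Sheaf.H.{u} ((piInv X).obj G) i)

/-- An open subset is cohomologically trivial if it is so as a topological space. -/
def CohTrivialOpen {X : TopCat.{u}} (U : Opens X) : Prop :=
  CohTrivial ((Opens.toTopCat X).obj U)

/-- A space is locally cohomologically trivial if its cohomologically trivial open subsets
form a basis of its topology. -/
def LocallyCohTrivial (X : TopCat.{u}) : Prop :=
  Opens.IsBasis {U : Opens X | CohTrivialOpen U}

/-- The sheaf `ℤ_U`: extension by zero to `X` of the constant sheaf `ℤ` on the open subset `U`,
i.e. the sheafification of the presheaf whose value on `V` is the free abelian group on the set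
of inclusions `V ⟶ U`, which is `ℤ` if `V ⊆ U` and `0` otherwise. -/
def intOpen {X : TopCat.{u}} (U : Opens X) : AbSheaf X :=
  (presheafToSheaf (Opens.grothendieckTopology X) AddCommGrpCat.{u}).obj
    (yoneda.obj U ⋙ AddCommGrpCat.free)

/-- A sheaf isomorphic to a direct sum of sheaves `ℤ_U` with `U` running over some family of
connected and cohomologically trivial open subsets (repetitions allowed). -/
def IsSumOfIntOpens {X : TopCat.{u}} (F : AbSheaf X) : Prop :=
  ∃ (ι : Type u) (U : ι → Opens X),
    (∀ i, IsConnected (U i : Set X) ∧ CohTrivialOpen (U i)) ∧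
    Nonempty (F ≅ ∐ fun i => intOpen (U i))

/-- (Unbounded) complexes of sheaves on `X`, with cohomological indexing. -/
abbrev SheafComplex (X : TopCat.{u}) : Type (u + 1) := CochainComplex (AbSheaf X) ℤ

section Cosections

variable (X : TopCat.{u}) [(piInv X).IsRightAdjoint]

/-- The cosections functor `L(X, -)`: the left adjoint of the constant sheaf functor. -/
def cosections : AbSheaf X ⥤ AddCommGrpCat.{u} := (piInv X).leftAdjoint

/-- The adjunction defining cosections. -/
def cosectionsAdj : cosections X ⊣ piInv X := Adjunction.ofIsRightAdjoint (piInv X)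

instance cosections_additive : (cosections X).Additive := (cosectionsAdj X).left_adjoint_additive

/-- The cosections functor on complexes, applied in each degree. -/
abbrev cosectionsComplex : SheafComplex X ⥤ CochainComplex AddCommGrpCat.{u} ℤ :=
  (cosections X).mapHomologicalComplex (ComplexShape.up ℤ)

/-- The constant sheaf functor on complexes, applied in each degree. -/
abbrev piInvComplex : CochainComplex AddCommGrpCat.{u} ℤ ⥤ SheafComplex X :=
  (piInv X).mapHomologicalComplex (ComplexShape.up ℤ)

/-- The natural morphism of complexes `F ⟶ π⁻¹ L(X, F)`, the unit of the adjunction in each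
degree. -/
def unitComplex : 𝟭 (SheafComplex X) ⟶ cosectionsComplex X ⋙ piInvComplex X where
  app F :=
    { f := fun n => (cosectionsAdj X).unit.app (F.X n)
      comm' := fun i j _ => ((cosectionsAdj X).unit.naturality (F.d i j)).symm }
  naturality F G f := by
    ext1 n
    exact (cosectionsAdj X).unit.naturality (f.f n)

end Cosections

section Derived

variable (X : TopCat.{u}) [HasDerivedCategory.{w} (AbSheaf X)]
  [HasDerivedCategory.{w'} AddCommGrpCat.{u}]

/-- The inverse image functor `π⁻¹ : D(ℤ) ⥤ D(X)` on unbounded derived categories, induced by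
the exact functor `π⁻¹`. -/
abbrev piInvD : DerivedCategory AddCommGrpCat.{u} ⥤ DerivedCategory (AbSheaf X) :=
  (piInv X).mapDerivedCategory

variable [(piInvD.{w, w'} X).IsRightAdjoint]

/-- The functor `𝕃(X, -) : D(X) ⥤ D(ℤ)`: the left adjoint of `π⁻¹ : D(ℤ) ⥤ D(X)`. -/
def homologyD : DerivedCategory (AbSheaf X) ⥤ DerivedCategory AddCommGrpCat.{u} :=
  (piInvD.{w, w'} X).leftAdjoint

/-- The adjunction defining `𝕃(X, -)`. -/
def homologyDAdj : homologyD.{w, w'} X ⊣ piInvD.{w, w'} X :=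
  Adjunction.ofIsRightAdjoint (piInvD.{w, w'} X)

variable [(piInv X).IsRightAdjoint]

/-- The natural morphism `𝕃(X, F) ⟶ L(X, F)` in `D(ℤ)`, for complexes of sheaves `F`: it is
adjoint to the image in `D(X)` of the morphism of complexes `F ⟶ π⁻¹ L(X, F)`. -/
def comparison :
    DerivedCategory.Q ⋙ homologyD.{w, w'} X ⟶ cosectionsComplex X ⋙ DerivedCategory.Q where
  app F := ((homologyDAdj.{w, w'} X).homEquiv _ _).symm
    (DerivedCategory.Q.map ((unitComplex X).app F) ≫
      (piInv X).mapDerivedCategoryFactors.inv.app ((cosectionsComplex X).obj F))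
  naturality F G f := by
    have h := (unitComplex X).naturality f
    have h' := (piInv X).mapDerivedCategoryFactors.inv.naturality ((cosectionsComplex X).map f)
    simp only [Functor.comp_map, Functor.id_map, Functor.comp_obj] at h h' ⊢
    rw [← Adjunction.homEquiv_naturality_left_symm, ← Adjunction.homEquiv_naturality_right_symm,
      ← Category.assoc, ← Functor.map_comp, h, Functor.map_comp, Category.assoc, Category.assoc]
    exact congrArg _ (congrArg _ h')

/-- A complex of sheaves is `L`-acyclic if `𝕃(X, F) ⟶ L(X, F)` is an isomorphism in `D(ℤ)`. -/
def IsLAcyclic (F : SheafComplex X) : Prop := IsIso ((comparison.{w, w'} X).app F)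

end Derived

end SheafHomology

end

/-! Let B be the poset of connected, cohomologically trivial opens. It is a basis: a connected
component of a cohomologically trivial open is clopen in it, so its ℤ_V is a retract and inherits
the vanishing of Ext (`exists_basicOpen`). Sheaves on X then form a reflective subcategory of
presheaves on B, with an exact reflection a and a fully faithful right adjoint r. Sections of a
constant sheaf over a connected open are constant, so r π⁻¹ is the constant presheaf functor. Its
left adjoint is the colimit over Bᵒᵖ, and the restriction of that colimit to sheaves is L
(`isRightAdjoint_piInv`).

Free presheaves on representables are compact projective generators. Attaching all possible cells
infinitely often, without choices, resolves every unbounded complex of presheaves functorially by a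
K-projective complex S with terms direct sums of these generators (`isKProjective_semifree`,
`quasiIso_semifreeπ`). Put C K = a S, where S resolves r K. Since a is exact and a r = id, C K
resolves K, and its terms are sums of sheaves ℤ_U.

The heart is that Hom(L C K, Z) → Hom(C K, π⁻¹ Z) is bijective for every Z in D(ℤ). As ℤ is
hereditary, Z is represented by a complex H with zero differentials (`exists_iso_Q_of_zero_d`). Take
I to be the product over n of injective resolutions of the constant sheaves Hⁿ, each placed in its
degree. Cohomological triviality makes π⁻¹ H → I a quasi-isomorphism already on sections over the
members of B, where products are exact (`exists_isKInjective_resolution`). With [ , ] for homotopy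
classes, `bijective_derivedHomMap` then runs through Hom(a S, π⁻¹ H) = [a S, I] = [S, r I] = [S, r
π⁻¹ H] = [L a S, H] = Hom(L a S, H). The first equality uses that I is K-injective, the third that S
is K-projective, and the last that L a S is K-projective because r π⁻¹ is exact.

Hence L C K corepresents the functor that 𝕃 must corepresent, so 𝕃 exists and α is an isomorphism on
C K. That 𝕃 is the left derived functor is then formal: acyclic functorial resolutions suffice
(`isRightKanExtension_of_resolution`). -/

noncomputable section

namespace SheafHomology

/-! ### Compact projective families and the attachment of cells. -/

section SemifreeResolution

open Opposite CochainComplex CochainComplex.HomComplex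

universe v v₁

variable {𝓐 : Type v₁} [Category.{v} 𝓐] {ι : Type v} (P : ι → 𝓐)

/-- A family of projective objects that is separating and such that morphisms from its members
commute with sequential colimits. -/
class IsCompactProjectiveFamily : Prop where
  projective : ∀ i, Projective (P i)
  hom_ext : ∀ {A B : 𝓐} (f g : A ⟶ B), (∀ (i : ι) (x : P i ⟶ A), x ≫ f = x ≫ g) → f = g
  preserves : ∀ i, PreservesColimitsOfShape ℕ (coyoneda.obj (op (P i)))

variable {P} in
/-- A family of objects which corepresent functors of the form `G ⋙ forget`, with the `G`
preserving epimorphisms and sequential colimits, and jointly faithful. -/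
lemma IsCompactProjectiveFamily.of_iso {G : ι → 𝓐 ⥤ AddCommGrpCat.{v}}
    (e : ∀ i, coyoneda.obj (op (P i)) ≅ G i ⋙ forget AddCommGrpCat.{v})
    [∀ i, (G i).PreservesEpimorphisms] [∀ i, PreservesColimitsOfShape ℕ (G i)]
    (hG : ∀ {A B : 𝓐} (f g : A ⟶ B), (∀ i, (G i).map f = (G i).map g) → f = g) :
    IsCompactProjectiveFamily P where
  projective i := by
    rw [Projective.projective_iff_preservesEpimorphisms_coyoneda_obj]
    have : (forget AddCommGrpCat.{v}).PreservesEpimorphisms := inferInstance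
    exact Functor.PreservesEpimorphisms.of_iso (e i).symm
  hom_ext f g h := hG f g (fun i => by
    apply (forget AddCommGrpCat.{v}).map_injective
    have hfg : (coyoneda.obj (op (P i))).map f = (coyoneda.obj (op (P i))).map g := by
      ext x
      exact h i x
    have h₁ := NatIso.naturality_1 (e i) f
    have h₂ := NatIso.naturality_1 (e i) g
    rw [hfg] at h₁
    exact h₁.symm.trans h₂)
  preserves i := by
    have : PreservesColimitsOfShape ℕ (forget AddCommGrpCat.{v}) :=
      have : PreservesFilteredColimits (forget AddCommGrpCat.{v}) := inferInstance
      have := PreservesFilteredColimitsOfSize.preserves_filtered_colimits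
        (F := forget AddCommGrpCat.{v}) (ULiftHom.{v} (ULift.{v} ℕ))
      preservesColimitsOfShape_of_equiv (ULiftHomULiftCategory.equiv.{v,v} ℕ).symm _
    exact preservesColimitsOfShape_of_natIso (e i).symm

section Elements

variable {P} [Abelian 𝓐] [IsCompactProjectiveFamily P]

instance (i : ι) : Projective (P i) := IsCompactProjectiveFamily.projective i

lemma mono_of_family {A B : 𝓐} (f : A ⟶ B)
    (h : ∀ (i : ι) (x : P i ⟶ A), x ≫ f = 0 → x = 0) : Mono f :=
  Preadditive.mono_of_cancel_zero _ fun g hg => IsCompactProjectiveFamily.hom_ext (P := P) _ _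
    fun i x => by
      rw [comp_zero]
      exact h i _ (by rw [Category.assoc, hg, comp_zero])

lemma epi_of_family {A B : 𝓐} (f : A ⟶ B)
    (h : ∀ (i : ι) (y : P i ⟶ B), ∃ x, x ≫ f = y) : Epi f :=
  Preadditive.epi_of_cancel_zero _ fun g hg => IsCompactProjectiveFamily.hom_ext (P := P) _ _
    fun i y => by
      obtain ⟨x, rfl⟩ := h i y
      rw [Category.assoc, hg, comp_zero, comp_zero]

/-- The lifting property of projective objects in terms of cohomology. -/
lemma exists_comp_homologyπ {K : CochainComplex 𝓐 ℤ} {n : ℤ} {T : 𝓐} [Projective T]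
    (x : T ⟶ K.homology n) : ∃ z : T ⟶ K.cycles n, z ≫ K.homologyπ n = x :=
  ⟨Projective.factorThru x (K.homologyπ n), Projective.factorThru_comp _ _⟩

lemma exists_of_comp_homologyπ_eq_zero {K : CochainComplex 𝓐 ℤ} {m n : ℤ} (hmn : m + 1 = n)
    {T : 𝓐} [Projective T]
    (z : T ⟶ K.cycles n) (hz : z ≫ K.homologyπ n = 0) :
    ∃ y : T ⟶ K.X m, y ≫ K.toCycles m n = z := by
  have hS : (ShortComplex.mk (K.toCycles m n) (K.homologyπ n) (by simp)).Exact :=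
    ShortComplex.exact_of_g_is_cokernel _
      (K.homologyIsCokernel m n (by simp [← hmn]))
  exact ⟨hS.liftFromProjective z hz, hS.liftFromProjective_comp _ _⟩

/-- Criterion for a morphism of complexes to be a quasi-isomorphism in terms of a family of
projective generators. -/
lemma quasiIso_of_family {K L : CochainComplex 𝓐 ℤ} (f : K ⟶ L)
    (h₁ : ∀ (m n n' : ℤ) (_ : m + 1 = n) (_ : n + 1 = n') (i : ι) (z : P i ⟶ L.X n),
      z ≫ L.d n n' = 0 → ∃ (x : P i ⟶ K.X n) (y : P i ⟶ L.X m),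
        x ≫ K.d n n' = 0 ∧ x ≫ f.f n = z + y ≫ L.d m n)
    (h₂ : ∀ (m n n' : ℤ) (_ : m + 1 = n) (_ : n + 1 = n') (i : ι) (z : P i ⟶ K.X n)
      (y : P i ⟶ L.X m), z ≫ K.d n n' = 0 → z ≫ f.f n = y ≫ L.d m n →
      ∃ x : P i ⟶ K.X m, x ≫ K.d m n = z) : QuasiIso f where
  quasiIsoAt n := by
    rw [quasiIsoAt_iff_isIso_homologyMap]
    have : Mono (HomologicalComplex.homologyMap f n) := mono_of_family (P := P) _ fun i x hx => by
      obtain ⟨z, rfl⟩ := exists_comp_homologyπ x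
      rw [Category.assoc, HomologicalComplex.homologyπ_naturality, ← Category.assoc] at hx
      obtain ⟨y, hy⟩ := exists_of_comp_homologyπ_eq_zero (sub_add_cancel n 1) _ hx
      obtain ⟨t, ht⟩ := h₂ (n - 1) n (n + 1) (by simp) rfl i (z ≫ K.iCycles n) y (by simp) (by
        have := congr($hy ≫ L.iCycles n)
        simpa using this.symm)
      have : z = t ≫ K.toCycles (n - 1) n := by
        rw [← cancel_mono (K.iCycles n), ← ht]
        simp
      rw [this]
      simp
    have : Epi (HomologicalComplex.homologyMap f n) := epi_of_family (P := P) _ fun i x => by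
      obtain ⟨z, rfl⟩ := exists_comp_homologyπ x
      obtain ⟨x, y, hx, hy⟩ := h₁ (n - 1) n (n + 1) (by simp) rfl i (z ≫ L.iCycles n) (by simp)
      refine ⟨K.liftCycles x (n + 1) (by simp) hx ≫ K.homologyπ n, ?_⟩
      have : K.liftCycles x (n + 1) (by simp) hx ≫ HomologicalComplex.cyclesMap f n =
          z + y ≫ L.toCycles (n - 1) n := by
        rw [← cancel_mono (L.iCycles n)]
        simp [hy]
      rw [Category.assoc, HomologicalComplex.homologyπ_naturality, reassoc_of% this]
      simp
    exact isIso_of_mono_of_epi _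

end Elements

section Step

variable [Preadditive 𝓐]

variable {K L K' L' : CochainComplex 𝓐 ℤ}

/-- The cells of type `P i` attached to the source of `p : K ⟶ L` in degree `n`: the cocycles of
`K` of degree `n` whose image in `L` is given as a coboundary. -/
@[ext]
structure Cell (p : K ⟶ L) (n : ℤ) (i : ι) : Type v where
  /-- the cocycle -/
  z : P i ⟶ K.X n
  /-- the cochain whose coboundary is the image of the cocycle -/
  y : P i ⟶ L.X (n + -1)
  z_d : z ≫ K.d n (n + 1) = 0
  y_d : y ≫ L.d (n + -1) n = z ≫ p.f n

variable {P} in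
/-- The action of commutative squares on cells. -/
@[simps]
def Cell.map {p : K ⟶ L} {p' : K' ⟶ L'} (a : K ⟶ K') (b : L ⟶ L') (h : p ≫ b = a ≫ p')
    {n : ℤ} {i : ι} (c : Cell P p n i) : Cell P p' n i where
  z := c.z ≫ a.f n
  y := c.y ≫ b.f _
  z_d := by simp [reassoc_of% c.z_d]
  y_d := by
    have := congr(($h).f n)
    dsimp at this
    simp [reassoc_of% c.y_d, this]

variable [HasCoproducts.{v} 𝓐]

/-- The complex with zero differential which is the sum of the attaching cells. -/
def cells (p : K ⟶ L) : CochainComplex 𝓐 ℤ where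
  X n := ∐ fun c : Σ i, Cell P p n i => P c.1
  d _ _ := 0

@[simp]
lemma cells_d (p : K ⟶ L) (n m : ℤ) : (cells P p).d n m = 0 := rfl

variable {P}

/-- The inclusion of a cell. -/
def cellsι {p : K ⟶ L} {n : ℤ} {i : ι} (c : Cell P p n i) : P i ⟶ (cells P p).X n :=
  Sigma.ι (fun c : Σ i, Cell P p n i => P c.1) ⟨i, c⟩

@[ext]
lemma cells_hom_ext {p : K ⟶ L} {n : ℤ} {T : 𝓐} {f g : (cells P p).X n ⟶ T}
    (h : ∀ i (c : Cell P p n i), cellsι c ≫ f = cellsι c ≫ g) : f = g :=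
  Sigma.hom_ext _ _ fun c => h c.1 c.2

/-- The morphism from the sum of the cells given by a family of morphisms. -/
def cellsDesc {p : K ⟶ L} {n : ℤ} {T : 𝓐} (f : ∀ i (_ : Cell P p n i), P i ⟶ T) :
    (cells P p).X n ⟶ T := Sigma.desc fun c => f c.1 c.2

@[simp]
lemma cellsι_desc {p : K ⟶ L} {n : ℤ} {T : 𝓐} (f : ∀ i (_ : Cell P p n i), P i ⟶ T)
    {i : ι} (c : Cell P p n i) : cellsι c ≫ cellsDesc f = f i c := Sigma.ι_desc _ _

@[simp]
lemma cellsι_desc_assoc {p : K ⟶ L} {n : ℤ} {T Z : 𝓐} (f : ∀ i (_ : Cell P p n i), P i ⟶ T)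
    {i : ι} (c : Cell P p n i) (g : T ⟶ Z) : cellsι c ≫ cellsDesc f ≫ g = f i c ≫ g := by
  rw [← Category.assoc, cellsι_desc]

variable (P)

/-- The attaching morphism. -/
@[simps]
def attach (p : K ⟶ L) : cells P p ⟶ K where
  f n := cellsDesc fun _ c => c.z
  comm' i j hij := by
    obtain rfl : i + 1 = j := hij
    ext _ c
    simp [c.z_d]

/-- The given homotopy from the attaching morphism, composed with `p`, to zero. -/
def attachHomotopy (p : K ⟶ L) : Cochain (cells P p) L (-1) :=
  Cochain.mk fun _ _ h => cellsDesc fun _ c => c.y ≫ (L.XIsoOfEq h).hom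

@[simp]
lemma cellsι_attachHomotopy_v (p : K ⟶ L) {n m : ℤ} (h : n + -1 = m) {i : ι} (c : Cell P p n i) :
    cellsι c ≫ (attachHomotopy P p).v n m h = c.y ≫ (L.XIsoOfEq h).hom := by
  exact cellsι_desc (fun _ (c : Cell P p n _) => c.y ≫ (L.XIsoOfEq h).hom) c

@[simp]
lemma cellsι_attachHomotopy_v_assoc (p : K ⟶ L) {n m : ℤ} (h : n + -1 = m) {i : ι}
    (c : Cell P p n i) {Z : 𝓐} (g : L.X m ⟶ Z) :
    cellsι c ≫ (attachHomotopy P p).v n m h ≫ g = c.y ≫ (L.XIsoOfEq h).hom ≫ g := by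
  rw [← Category.assoc, cellsι_attachHomotopy_v, Category.assoc]

lemma δ_attachHomotopy (p : K ⟶ L) :
    δ (-1) 0 (attachHomotopy P p) = Cochain.ofHom (attach P p ≫ p) := by
  ext n i c
  rw [δ_v (-1) 0 (by simp) _ n n (by simp) (n + -1) (n + 1) (by lia) rfl]
  have := c.y_d
  simp [this]

/-- The action of commutative squares on sums of cells. -/
@[simps]
def cellsMap {p : K ⟶ L} {p' : K' ⟶ L'} (a : K ⟶ K') (b : L ⟶ L') (h : p ≫ b = a ≫ p') :
    cells P p ⟶ cells P p' where
  f n := cellsDesc fun _ c => cellsι (c.map a b h)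

lemma attach_naturality {p : K ⟶ L} {p' : K' ⟶ L'} (a : K ⟶ K') (b : L ⟶ L')
    (h : p ≫ b = a ≫ p') : attach P p ≫ a = cellsMap P a b h ≫ attach P p' := by
  ext n i c
  simp

lemma cellsMap_id (p : K ⟶ L) : cellsMap P (p := p) (p' := p) (𝟙 _) (𝟙 _) (by simp) = 𝟙 _ := by
  ext n i c
  have : c.map (p := p) (p' := p) (𝟙 _) (𝟙 _) (by simp) = c := by
    ext <;> simp
  simp [this]

lemma cellsMap_comp {K'' L'' : CochainComplex 𝓐 ℤ} {p : K ⟶ L} {p' : K' ⟶ L'} {p'' : K'' ⟶ L''}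
    (a : K ⟶ K') (b : L ⟶ L') (h : p ≫ b = a ≫ p')
    (a' : K' ⟶ K'') (b' : L' ⟶ L'') (h' : p' ≫ b' = a' ≫ p'')
    (h'' : p ≫ b ≫ b' = (a ≫ a') ≫ p'') :
    cellsMap P (a ≫ a') (b ≫ b') h'' = cellsMap P a b h ≫ cellsMap P a' b' h' := by
  ext n i c
  have : c.map (a ≫ a') (b ≫ b') h'' = (c.map a b h).map a' b' h' := by
    ext <;> simp
  simp [this]

variable [HasBinaryBiproducts 𝓐]

/-- The complex obtained by attaching all cells to the source of `p`. -/
abbrev step (p : K ⟶ L) : CochainComplex 𝓐 ℤ := mappingCone (attach P p)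

/-- The inclusion in the complex obtained by attaching cells. -/
def stepι (p : K ⟶ L) : K ⟶ step P p := mappingCone.inr _

/-- The extension of `p` to the complex obtained by attaching cells. -/
def stepπ (p : K ⟶ L) : step P p ⟶ L :=
  mappingCone.desc (attach P p) (attachHomotopy P p) p (δ_attachHomotopy P p)

@[simp]
lemma stepι_stepπ (p : K ⟶ L) : stepι P p ≫ stepπ P p = p := mappingCone.inr_desc _ _ _ _

/-- The action of commutative squares on complexes obtained by attaching cells. -/
def stepMap {p : K ⟶ L} {p' : K' ⟶ L'} (a : K ⟶ K') (b : L ⟶ L') (h : p ≫ b = a ≫ p') :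
    step P p ⟶ step P p' :=
  mappingCone.map _ _ (cellsMap P a b h) a (attach_naturality P a b h)

@[simp]
lemma stepι_stepMap {p : K ⟶ L} {p' : K' ⟶ L'} (a : K ⟶ K') (b : L ⟶ L') (h : p ≫ b = a ≫ p') :
    stepι P p ≫ stepMap P a b h = a ≫ stepι P p' := by
  simp [stepι, stepMap, mappingCone.map]

@[simp]
lemma stepMap_stepπ {p : K ⟶ L} {p' : K' ⟶ L'} (a : K ⟶ K') (b : L ⟶ L') (h : p ≫ b = a ≫ p') :
    stepMap P a b h ≫ stepπ P p' = stepπ P p ≫ b := by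
  ext n
  refine mappingCone.ext_from _ (n + 1) n rfl ?_ ?_
  · ext i c
    simp [stepMap, stepπ, mappingCone.map, HomologicalComplex.XIsoOfEq_hom_naturality]
  · have := congr(($h).f n)
    simp [stepMap, stepπ, mappingCone.map] at this ⊢
    exact this.symm

lemma stepMap_eq_id {p : K ⟶ L} {a : K ⟶ K} {b : L ⟶ L} (h : p ≫ b = a ≫ p)
    (ha : a = 𝟙 K) (hb : b = 𝟙 L) : stepMap P a b h = 𝟙 _ := by
  subst ha hb
  simp only [stepMap, cellsMap_id]
  exact mappingCone.map_id _

lemma stepMap_eq_comp {K'' L'' : CochainComplex 𝓐 ℤ} {p : K ⟶ L} {p' : K' ⟶ L'} {p'' : K'' ⟶ L''}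
    {a : K ⟶ K'} {b : L ⟶ L'} (h : p ≫ b = a ≫ p')
    {a' : K' ⟶ K''} {b' : L' ⟶ L''} (h' : p' ≫ b' = a' ≫ p'')
    {a'' : K ⟶ K''} {b'' : L ⟶ L''} (h'' : p ≫ b'' = a'' ≫ p'')
    (ha : a'' = a ≫ a') (hb : b'' = b ≫ b') :
    stepMap P a'' b'' h'' = stepMap P a b h ≫ stepMap P a' b' h' := by
  subst ha hb
  simp only [stepMap, cellsMap_comp P a b h a' b' h']
  exact mappingCone.map_comp ..

variable {P} in
-- The pair `(z, y)` is itself a cell, and `x` is its inclusion in the mapping cone, which lowers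
-- the degree by one.
lemma exists_step_d_eq (p : K ⟶ L) {m n n' : ℤ} (hm : m + 1 = n) (hn : n + 1 = n') {i : ι}
    (z : P i ⟶ K.X n) (y : P i ⟶ L.X m) (hz : z ≫ K.d n n' = 0)
    (hy : y ≫ L.d m n = z ≫ p.f n) :
    ∃ x : P i ⟶ (step P p).X m, x ≫ (step P p).d m n = z ≫ (stepι P p).f n ∧
      x ≫ (stepπ P p).f m = y := by
  obtain rfl : m = n + -1 := by lia
  subst hn
  let c : Cell P p n i := ⟨z, y, hz, hy⟩
  refine ⟨cellsι c ≫ (mappingCone.inl (attach P p)).v n (n + -1) rfl, ?_, ?_⟩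
  · rw [Category.assoc, mappingCone.inl_v_d _ n (n + -1) (n + 1) rfl (by lia)]
    simp [stepι, c]
  · rw [Category.assoc, stepπ, mappingCone.inl_v_desc_f]
    simp [c]

end Step

end SemifreeResolution

/-! ### Sequential colimits of cell attachments and the functorial semifree resolution. -/

section SemifreeResolution

open Opposite CochainComplex CochainComplex.HomComplex

universe v v₁

section SequentialColimits

variable {𝓐 : Type v₁} [Category.{v} 𝓐]

/-- A sequential colimit of coproduct inclusions `D j ⟶ D (j + 1)`, starting from an initial
object, is the coproduct of the complements. -/
theorem nonempty_isColimit_of_sequence (D : ℕ ⥤ 𝓐) (h₀ : IsInitial (D.obj 0)) {T : ℕ → 𝓐}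
    (t : ∀ j, T j ⟶ D.obj (j + 1))
    (h : ∀ j, IsColimit (BinaryCofan.mk (t j) (D.map (homOfLE (j.le_add_right 1)))))
    {c : Cocone D} (hc : IsColimit c) :
    Nonempty (IsColimit (Cofan.mk c.pt fun j => t j ≫ c.ι.app (j + 1))) := by
  have exists_desc (Z : 𝓐) (s : ∀ j, T j ⟶ Z) :
      ∃ g : c.pt ⟶ Z, ∀ j, t j ≫ c.ι.app (j + 1) ≫ g = s j := by
    let g (j : ℕ) : D.obj j ⟶ Z :=
      Nat.rec (h₀.to Z) (fun j g => (h j).desc (BinaryCofan.mk (s j) g)) j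
    have hg (j : ℕ) : D.map (homOfLE (j.le_add_right 1)) ≫ g (j + 1) = g j :=
      (h j).fac (BinaryCofan.mk (s j) (g j)) ⟨WalkingPair.right⟩
    have hg' (j : ℕ) : t j ≫ g (j + 1) = s j :=
      (h j).fac (BinaryCofan.mk (s j) (g j)) ⟨WalkingPair.left⟩
    let α : D ⟶ (Functor.const ℕ).obj Z := NatTrans.ofSequence g fun j => by simp [hg]
    refine ⟨hc.desc ⟨Z, α⟩, fun j => ?_⟩
    rw [hc.fac, ← hg' j]
    rfl
  have hom_ext (Z : 𝓐) (g g' : c.pt ⟶ Z)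
      (hg : ∀ j, t j ≫ c.ι.app (j + 1) ≫ g = t j ≫ c.ι.app (j + 1) ≫ g') : g = g' := by
    refine hc.hom_ext fun j => ?_
    induction j with
    | zero => exact h₀.hom_ext _ _
    | succ j ih =>
      refine BinaryCofan.IsColimit.hom_ext (h j) (hg j) ?_
      rw [← c.w (homOfLE (j.le_add_right 1)), Category.assoc, Category.assoc] at ih
      exact ih
  choose d hd using exists_desc
  exact ⟨Cofan.IsColimit.mk _ (fun s => d s.pt s.inj) (fun s j => (Category.assoc _ _ _).trans (hd _ _ _))
    fun s m hm => hom_ext _ _ _ fun j => by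
      rw [hd, ← hm j]
      exact (Category.assoc _ _ _).symm⟩

end SequentialColimits

section

variable {𝓐 : Type v₁} [Category.{v} 𝓐] [Abelian 𝓐]

/-- A cocycle from a complex of projective objects with zero differential to an acyclic complex
is a coboundary. -/
lemma exists_δ_eq_of_d_eq_zero {S N : CochainComplex 𝓐 ℤ} [∀ n, Projective (S.X n)]
    (hS : ∀ n m, S.d n m = 0) (hN : N.Acyclic) {k l : ℤ} (hkl : k + 1 = l) (β : Cochain S N l)
    (hβ : δ l (l + 1) β = 0) : ∃ α : Cochain S N k, δ k l α = β := by
  -- As `S` has zero differential, the cocycle condition on `β` only says that each component lands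
  -- in the cocycles of `N`; these are boundaries, and projectivity lifts.
  have key (n m : ℤ) (h : n + k = m) : ∃ a : S.X n ⟶ N.X m,
      a ≫ N.d m (m + 1) = β.v n (m + 1) (by lia) := by
    have h₁ := (N.exactAt_iff' m (m + 1) (m + 2) (by simp) (by simp; lia)).1 (hN (m + 1))
    have h₂ := Cochain.congr_v hβ n (m + 2) (by lia)
    rw [δ_v l (l + 1) rfl _ n (m + 2) (by lia) (m + 1) (n + 1) (by lia) rfl, hS] at h₂
    simp only [zero_comp, smul_zero, add_zero, Cochain.zero_v] at h₂
    exact ⟨h₁.liftFromProjective _ h₂, h₁.liftFromProjective_comp _ h₂⟩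
  choose a ha using key
  refine ⟨Cochain.mk a, ?_⟩
  ext n m h
  obtain rfl : m = (n + k) + 1 := by lia
  rw [δ_v k l hkl _ n _ h (n + k) (n + 1) (by lia) rfl, hS]
  simp [ha n (n + k) rfl]

/-- A sequential colimit of mapping cones of morphisms from complexes of projective objects with
zero differential is K-projective. -/
theorem isKProjective_of_sequence (D : ℕ ⥤ CochainComplex 𝓐 ℤ) (h₀ : IsZero (D.obj 0))
    {S : ℕ → CochainComplex 𝓐 ℤ} [∀ j n, Projective ((S j).X n)]
    (hS : ∀ j n m, (S j).d n m = 0) (φ : ∀ j, S j ⟶ D.obj j)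
    (e : ∀ j, mappingCone (φ j) ≅ D.obj (j + 1))
    (he : ∀ j, mappingCone.inr (φ j) ≫ (e j).hom = D.map (homOfLE (j.le_add_right 1)))
    {c : Cocone D} (hc : ∀ n : ℤ, IsColimit ((HomologicalComplex.eval 𝓐 _ n).mapCocone c)) :
    c.pt.IsKProjective where
  nonempty_homotopy_zero {N} f hN := by
    have extend (j : ℕ) (h : Cochain (D.obj j) N (-1))
        (hh : δ (-1) 0 h = Cochain.ofHom (c.ι.app j ≫ f)) :
        ∃ h' : Cochain (D.obj (j + 1)) N (-1),
          δ (-1) 0 h' = Cochain.ofHom (c.ι.app (j + 1) ≫ f) ∧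
          (Cochain.ofHom (D.map (homOfLE (j.le_add_right 1)))).comp h' (zero_add _) = h := by
      have hf : mappingCone.inr (φ j) ≫ (e j).hom ≫ c.ι.app (j + 1) ≫ f = c.ι.app j ≫ f := by
        rw [reassoc_of% he j, Cocone.w_assoc]
      -- The obstruction to extending `h` over the cone is a cocycle of degree -1 on `S j`; a
      -- primitive `α` of degree -2 supplies the values of the homotopy on the new cells.
      obtain ⟨α, hα⟩ := exists_δ_eq_of_d_eq_zero (hS j) hN (show -2 + 1 = -1 by lia)
        ((mappingCone.inl (φ j)).comp (Cochain.ofHom ((e j).hom ≫ c.ι.app (j + 1) ≫ f))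
          (add_zero _) - (Cochain.ofHom (φ j)).comp h (zero_add _)) (by
          simp only [Int.reduceNeg, Int.reduceAdd, δ_sub, δ_comp_ofHom, δ_ofHom_comp,
            mappingCone.δ_inl, hh, ← Cochain.ofHom_comp, Category.assoc, hf, sub_self])
      have hdesc : δ (-1) 0 (mappingCone.descCochain (φ j) α h (by lia)) =
          Cochain.ofHom ((e j).hom ≫ c.ι.app (j + 1) ≫ f) := by
        rw [mappingCone.δ_descCochain _ _ _ _ _ (by lia), hα,
          mappingCone.ext_cochain_from_iff _ (-1) 0 (by lia)]
        constructor
        · simp [Cochain.comp_add]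
        · simp [Cochain.comp_add, hh, hf, ← Cochain.ofHom_comp]
      refine ⟨(Cochain.ofHom (e j).inv).comp (mappingCone.descCochain (φ j) α h (by lia))
        (zero_add _), ?_, ?_⟩
      · rw [δ_ofHom_comp, hdesc, ← Cochain.ofHom_comp, Iso.inv_hom_id_assoc]
      · rw [← Cochain.comp_assoc_of_first_is_zero_cochain, ← Cochain.ofHom_comp, ← he,
          Category.assoc, Iso.hom_inv_id, Category.comp_id, mappingCone.inr_descCochain]
    choose next hnext hnext' using extend
    let h (j : ℕ) : { h : Cochain (D.obj j) N (-1) //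
        δ (-1) 0 h = Cochain.ofHom (c.ι.app j ≫ f) } :=
      Nat.rec ⟨0, by
        ext n
        exact ((HomologicalComplex.eval 𝓐 _ n).map_isZero h₀).eq_of_src _ _⟩
        (fun j h => ⟨next j h.1 h.2, hnext j h.1 h.2⟩) j
    -- The homotopies restrict to one another strictly, not just up to homotopy, so they glue on the
    -- degreewise colimit.
    have hh (j : ℕ) :
        (Cochain.ofHom (D.map (homOfLE (j.le_add_right 1)))).comp (h (j + 1)).1 (zero_add _) =
          (h j).1 := hnext' j (h j).1 (h j).2
    let γ : Cochain c.pt N (-1) := Cochain.mk fun n m hnm => (hc n).desc ⟨N.X m,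
      NatTrans.ofSequence (fun j => (h j).1.v n m hnm) fun j => by
        have := Cochain.congr_v (hh j) n m hnm
        rw [Cochain.zero_cochain_comp_v, Cochain.ofHom_v] at this
        exact this.trans (Category.comp_id _).symm⟩
    have hγ (j n m) (hnm : n + -1 = m) : (c.ι.app j).f n ≫ γ.v n m hnm = (h j).1.v n m hnm :=
      (hc n).fac _ j
    refine ⟨(Cochain.equivHomotopy f 0).symm ⟨γ, ?_⟩⟩
    rw [Cochain.ofHom_zero, add_zero]
    ext n
    refine (hc n).hom_ext fun j => ?_
    have := Cochain.congr_v (h j).2 n n (add_zero n)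
    rw [δ_v (-1) 0 (by simp) _ n n (by simp) (n - 1) (n + 1) rfl rfl] at this ⊢
    rw [← hγ, ← hγ] at this
    change (c.ι.app j).f n ≫ _ = (c.ι.app j).f n ≫ (_ + _)
    rw [Preadditive.comp_add]
    simpa [← HomologicalComplex.Hom.comm_assoc] using this.symm

/-- A mapping cone is degreewise a coproduct. -/
def isColimitMappingCone {K L : CochainComplex 𝓐 ℤ} (φ : K ⟶ L) (n : ℤ) :
    IsColimit (BinaryCofan.mk ((mappingCone.inl φ).v (n + 1) n (by lia))
      ((mappingCone.inr φ).f n)) :=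
  BinaryCofan.IsColimit.mk _
    (fun f g => (mappingCone.fst φ).1.v n (n + 1) rfl ≫ f +
      (mappingCone.snd φ).v n n (add_zero n) ≫ g)
    (fun f g => by
      change (mappingCone.inl φ).v (n + 1) n (by lia) ≫ _ = _
      simp)
    (fun f g => by
      change (mappingCone.inr φ).f n ≫ _ = _
      simp)
    (fun f g m hf hg => by
      refine mappingCone.ext_from φ (n + 1) n rfl (hf.trans ?_) (hg.trans ?_)
      all_goals simp)

/-- A sequential colimit over `F` is quasi-isomorphic to `F` if each cocycle at one stage which is
killed in the cohomology of `F` is killed at the next stage, in a way compatible with `F`. -/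
theorem quasiIso_of_sequence {ι : Type v} {P : ι → 𝓐} [IsCompactProjectiveFamily P]
    (D : ℕ ⥤ CochainComplex 𝓐 ℤ) {C F : CochainComplex 𝓐 ℤ} (c : ∀ j, D.obj j ⟶ C)
    (hc : ∀ {j j'} (h : j ≤ j'), D.map (homOfLE h) ≫ c j' = c j) (p : C ⟶ F)
    (h₁ : ∀ (n : ℤ) (i : ι) (z : P i ⟶ C.X n), ∃ j z', z = z' ≫ (c j).f n)
    (h₂ : ∀ (n : ℤ) (i : ι) (j : ℕ) (z : P i ⟶ (D.obj j).X n), z ≫ (c j).f n = 0 →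
      ∃ (j' : ℕ) (h : j ≤ j'), z ≫ (D.map (homOfLE h)).f n = 0)
    (h : ∀ (j : ℕ) (m n n' : ℤ) (_ : m + 1 = n) (_ : n + 1 = n') (i : ι)
      (z : P i ⟶ (D.obj j).X n) (y : P i ⟶ F.X m), z ≫ (D.obj j).d n n' = 0 →
      y ≫ F.d m n = z ≫ (c j ≫ p).f n → ∃ x : P i ⟶ (D.obj (j + 1)).X m,
        x ≫ (D.obj (j + 1)).d m n = z ≫ (D.map (homOfLE (j.le_add_right 1))).f n ∧
        x ≫ (c (j + 1) ≫ p).f m = y) : QuasiIso p := by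
  refine quasiIso_of_family (P := P) _ ?_ ?_
  · rintro m n n' hm hn i z hz
    -- A cocycle of `F` is hit by the cell attached along the zero cocycle one degree higher; that
    -- cell has zero boundary.
    obtain ⟨x, hx, hx'⟩ := h 0 n n' (n' + 1) hn rfl i 0 z (by simp) (by simp [hz])
    rw [zero_comp] at hx
    refine ⟨x ≫ (c 1).f n, 0, ?_, ?_⟩
    · rw [Category.assoc, (c 1).comm, reassoc_of% hx, zero_comp]
    · simpa using hx'
  · rintro m n n' hm hn i z y hz hy
    obtain ⟨j, z, rfl⟩ := h₁ n i z
    -- The representative at stage `j` need not be a cocycle there, but it becomes one at a later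
    -- stage, where the cell killing it can be attached.
    obtain ⟨j', hj, hj'⟩ := h₂ n' i j (z ≫ (D.obj j).d n n') (by
      rw [Category.assoc] at hz
      rw [Category.assoc, ← (c j).comm, hz])
    have hz' : z ≫ (c j).f n = (z ≫ (D.map (homOfLE hj)).f n) ≫ (c j').f n := by
      rw [Category.assoc, ← HomologicalComplex.comp_f, hc]
    rw [hz'] at hy ⊢
    obtain ⟨x, hx, -⟩ := h j' m n n' hm hn i (z ≫ (D.map (homOfLE hj)).f n) y (by
      rw [Category.assoc, HomologicalComplex.Hom.comm, ← Category.assoc, hj'])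
      (by rw [← hy, HomologicalComplex.comp_f, Category.assoc])
    refine ⟨x ≫ (c (j' + 1)).f m, ?_⟩
    rw [Category.assoc, (c (j' + 1)).comm, reassoc_of% hx, ← HomologicalComplex.comp_f, hc,
      Category.assoc]

end

section Functor

variable {𝓐 : Type v₁} [Category.{v} 𝓐] [Abelian 𝓐] {ι : Type v} (P : ι → 𝓐)
  [HasCoproducts.{v} 𝓐]

/-- Attaching cells, as an operation on functors over the identity functor. -/
def stepOver (K : Over (𝟭 (CochainComplex 𝓐 ℤ))) : Over (𝟭 (CochainComplex 𝓐 ℤ)) :=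
  Over.mk (Y :=
    { obj F := step P (K.hom.app F)
      map f := stepMap P (K.left.map f) f (K.hom.naturality f).symm
      map_id F := stepMap_eq_id _ _ (K.left.map_id F) rfl
      map_comp f g := stepMap_eq_comp _ _ _ _ (K.left.map_comp f g) rfl })
    { app F := stepπ P (K.hom.app F)
      naturality _ _ _ := stepMap_stepπ _ _ _ _ }

/-- The inclusion in the functor obtained by attaching cells. -/
def toStepOver (K : Over (𝟭 (CochainComplex 𝓐 ℤ))) : K ⟶ stepOver P K :=
  Over.homMk
    { app F := stepι P (K.hom.app F)
      naturality _ _ _ := (stepι_stepMap _ _ _ _).symm } (by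
    ext1
    ext1 F
    exact stepι_stepπ P (K.hom.app F))

open ZeroObject in
/-- The iterations of the attachment of cells, starting from zero. -/
def cellIteration (j : ℕ) : Over (𝟭 (CochainComplex 𝓐 ℤ)) :=
  Nat.rec (Over.mk (0 : (0 : CochainComplex 𝓐 ℤ ⥤ CochainComplex 𝓐 ℤ) ⟶ 𝟭 _)) (fun _ K => stepOver P K) j

/-- The sequence of iterations of the attachment of cells, starting from zero. -/
def cellSequence : ℕ ⥤ Over (𝟭 (CochainComplex 𝓐 ℤ)) :=
  Functor.ofSequence (X := cellIteration P) fun j => toStepOver P (cellIteration P j)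

variable {P} (F : CochainComplex 𝓐 ℤ)

variable (P) in
/-- The sequence of iterations of the attachment of cells, evaluated at a complex. -/
abbrev cellSequenceAt : ℕ ⥤ CochainComplex 𝓐 ℤ :=
  (cellSequence P ⋙ Over.forget _) ⋙ (evaluation _ _).obj F

variable (P) in
/-- The augmentation of an iteration of the attachment of cells. -/
abbrev cellπ (j : ℕ) : (cellSequenceAt P F).obj j ⟶ F := ((cellSequence P).obj j).hom.app F

lemma cellSequenceAt_map (j : ℕ) :
    mappingCone.inr (attach P (cellπ P F j)) =
      (cellSequenceAt P F).map (homOfLE (j.le_add_right 1)) := by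
  have := Functor.ofSequence_map_homOfLE_succ (X := cellIteration P)
    (fun j => toStepOver P (cellIteration P j)) j
  exact congr(($this).left.app F).symm

lemma isZero_cellSequenceAt : IsZero ((cellSequenceAt P F).obj 0) :=
  ((evaluation _ _).obj F).map_isZero (isZero_zero (CochainComplex 𝓐 ℤ ⥤ CochainComplex 𝓐 ℤ))

variable [HasColimitsOfShape ℕ 𝓐]

variable (P) in
/-- The semifree resolution functor: the colimit of the iterated attachment of cells. -/
def semifree : CochainComplex 𝓐 ℤ ⥤ CochainComplex 𝓐 ℤ :=
  colimit (cellSequence P ⋙ Over.forget _)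

variable (P) in
/-- The augmentation of the semifree resolution. -/
def semifreeπ : semifree P ⟶ 𝟭 (CochainComplex 𝓐 ℤ) :=
  colimit.desc _ ((Over.forgetCocone _).whisker (cellSequence P))

variable (P) in
/-- The semifree resolution of `F` as a cocone. -/
abbrev semifreeCocone : Cocone (cellSequenceAt P F) :=
  ((evaluation _ _).obj F).mapCocone (colimit.cocone (cellSequence P ⋙ Over.forget _))

lemma semifreeCocone_π (j : ℕ) :
    (semifreeCocone P F).ι.app j ≫ (semifreeπ P).app F = cellπ P F j :=
  congr_app (colimit.ι_desc (F := cellSequence P ⋙ Over.forget _)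
    ((Over.forgetCocone _).whisker (cellSequence P)) j) F

/-- The semifree resolution is a degreewise colimit. -/
def isColimitSemifreeCocone (n : ℤ) :
    IsColimit ((HomologicalComplex.eval 𝓐 _ n).mapCocone (semifreeCocone P F)) :=
  isColimitOfPreserves _ (isColimitOfPreserves _ (colimit.isColimit _))

instance [∀ i, Projective (P i)] {K L : CochainComplex 𝓐 ℤ} (p : K ⟶ L) (n : ℤ) :
    Projective ((cells P p).X n) :=
  inferInstanceAs (Projective (∐ fun c : Σ i, Cell P p n i => P c.1))

instance isKProjective_semifree [∀ i, Projective (P i)] :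
    ((semifree P).obj F).IsKProjective :=
  isKProjective_of_sequence (cellSequenceAt P F) (isZero_cellSequenceAt F)
    (S := fun j => cells P (cellπ P F j)) (fun _ _ _ => rfl) (fun _ => attach P _)
    (fun _ => Iso.refl _) (fun j => (Category.comp_id _).trans (cellSequenceAt_map F j))
    (isColimitSemifreeCocone F)

/-- The terms of the semifree resolution are direct sums of the given objects. -/
theorem exists_semifree_X_iso (n : ℤ) :
    ∃ (κ : Type v) (i : κ → ι), Nonempty (((semifree P).obj F).X n ≅ ∐ fun k => P (i k)) := by
  let t (j : ℕ) : (cells P (cellπ P F j)).X (n + 1) ⟶ ((cellSequenceAt P F).obj (j + 1)).X n :=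
    (mappingCone.inl (attach P (cellπ P F j))).v (n + 1) n (by lia)
  -- In a fixed degree the differentials are forgotten, and each cone only adds the cells of degree
  -- `n + 1` as a summand.
  obtain ⟨h⟩ := nonempty_isColimit_of_sequence (cellSequenceAt P F ⋙ HomologicalComplex.eval _ _ n)
    (((HomologicalComplex.eval _ _ n).map_isZero (isZero_cellSequenceAt F)).isInitial) t
    (fun j => by
      have := isColimitMappingCone (attach P (cellπ P F j)) n
      rw [cellSequenceAt_map] at this
      exact this) (isColimitSemifreeCocone F n)
  let κ := Σ (j : ℕ) (i : ι), Cell P (cellπ P F j) (n + 1) i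
  let c : Cofan (fun k : κ => P k.2.1) := Cofan.mk (((semifree P).obj F).X n) fun k =>
    cellsι k.2.2 ≫ t k.1 ≫ ((semifreeCocone P F).ι.app (k.1 + 1)).f n
  have hc : IsColimit c := Cofan.IsColimit.mk _
    (fun s => Cofan.IsColimit.desc h fun j => cellsDesc fun i c => s.inj ⟨j, i, c⟩)
    (fun s k => by
      have := Cofan.IsColimit.fac h (fun j => cellsDesc fun i c => s.inj ⟨j, i, c⟩) k.1
      refine (Category.assoc _ _ _).trans ?_
      refine (congrArg (fun g => cellsι k.2.2 ≫ g) this).trans ?_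
      exact cellsι_desc (fun i c => s.inj ⟨k.1, i, c⟩) k.2.2)
    (fun s m hm => Cofan.IsColimit.hom_ext h _ _ fun j => by
      rw [Cofan.IsColimit.fac]
      ext i c
      rw [cellsι_desc, ← hm ⟨j, i, c⟩]
      exact (Category.assoc _ _ _).symm)
  exact ⟨κ, fun k => k.2.1, ⟨hc.coconePointUniqueUpToIso (coproductIsCoproduct _)⟩⟩

lemma exists_eq_comp_semifreeCocone [IsCompactProjectiveFamily P] {n : ℤ} {i : ι}
    (z : P i ⟶ ((semifree P).obj F).X n) :
    ∃ (j : ℕ) (z' : P i ⟶ ((cellSequenceAt P F).obj j).X n),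
      z = z' ≫ ((semifreeCocone P F).ι.app j).f n := by
  have := IsCompactProjectiveFamily.preserves (P := P) i
  obtain ⟨j, z', hz'⟩ := Types.jointly_surjective _
    (isColimitOfPreserves (coyoneda.obj (op (P i))) (isColimitSemifreeCocone F n)) z
  exact ⟨j, z', hz'.symm⟩

lemma exists_comp_map_eq_zero [IsCompactProjectiveFamily P] {n : ℤ} {i : ι} {j : ℕ}
    (z : P i ⟶ ((cellSequenceAt P F).obj j).X n)
    (hz : z ≫ ((semifreeCocone P F).ι.app j).f n = 0) :
    ∃ (j' : ℕ) (h : j ≤ j'), z ≫ ((cellSequenceAt P F).map (homOfLE h)).f n = 0 := by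
  have := IsCompactProjectiveFamily.preserves (P := P) i
  obtain ⟨j', f, g, h⟩ := (Types.FilteredColimit.isColimit_eq_iff _
    (isColimitOfPreserves (coyoneda.obj (op (P i))) (isColimitSemifreeCocone F n))
    (xi := z) (xj := (0 : P i ⟶ ((cellSequenceAt P F).obj j).X n))).1
      (hz.trans zero_comp.symm)
  exact ⟨j', leOfHom f, h.trans zero_comp⟩

/-- The augmentation of the semifree resolution is a quasi-isomorphism. -/
instance quasiIso_semifreeπ [IsCompactProjectiveFamily P] : QuasiIso ((semifreeπ P).app F) := by
  refine quasiIso_of_sequence (P := P) (cellSequenceAt P F) (semifreeCocone P F).ι.app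
    (fun h => (semifreeCocone P F).w (homOfLE h)) _
    (fun _ _ => exists_eq_comp_semifreeCocone F) (fun _ _ _ => exists_comp_map_eq_zero F) ?_
  intro j m n n' hm hn i z y hz hy
  rw [semifreeCocone_π] at hy ⊢
  obtain ⟨x, hx, hx'⟩ := exists_step_d_eq (cellπ P F j) hm hn z y hz hy
  refine ⟨x, hx.trans ?_, hx'⟩
  rw [← cellSequenceAt_map]
  rfl

end Functor

end SemifreeResolution

/-! ### Adjunctions on complexes, homotopies, and morphisms in derived categories. -/

section Adjunction

open CochainComplex HomologicalComplex

universe v₁ v₂ v₃ u₁ u₂ u₃ w₁ w₂ w₃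

section Complexes

variable {𝓐 : Type u₁} {𝓑 : Type u₂} [Category.{v₁} 𝓐] [Category.{v₂} 𝓑]

/-- An adjunction between additive functors induces an adjunction on cochain complexes. -/
@[simps! unit]
def mapComplexAdjunction [Preadditive 𝓐] [Preadditive 𝓑] {F : 𝓐 ⥤ 𝓑} {G : 𝓑 ⥤ 𝓐}
    (adj : F ⊣ G) [F.Additive] [G.Additive] :
    F.mapHomologicalComplex (ComplexShape.up ℤ) ⊣ G.mapHomologicalComplex (ComplexShape.up ℤ) :=
  Adjunction.mkOfUnitCounit
    { unit :=
        { app := fun K =>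
            { f := fun n => adj.unit.app (K.X n)
              comm' := fun i j _ => (adj.unit.naturality (K.d i j)).symm }
          naturality := fun K L f => by
            ext1 n
            exact adj.unit.naturality (f.f n) }
      counit :=
        { app := fun K =>
            { f := fun n => adj.counit.app (K.X n)
              comm' := fun i j _ => (adj.counit.naturality (K.d i j)).symm }
          naturality := fun K L f => by
            ext1 n
            exact adj.counit.naturality (f.f n) }
      left_triangle := by
        ext K n
        exact (congrArg _ (Category.id_comp _)).trans (adj.left_triangle_components (K.X n))
      right_triangle := by
        ext K n
        exact (congrArg _ (Category.id_comp _)).trans (adj.right_triangle_components (K.X n)) }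

variable [Abelian 𝓐] [Abelian 𝓑] {F : 𝓐 ⥤ 𝓑} {G : 𝓑 ⥤ 𝓐} (adj : F ⊣ G) [F.Additive]
  [G.Additive] {K : CochainComplex 𝓐 ℤ} {L : CochainComplex 𝓑 ℤ}

/-- The adjunction on complexes is compatible with homotopies. -/
lemma nonempty_homotopy_homEquiv_iff
    (f g : (F.mapHomologicalComplex (ComplexShape.up ℤ)).obj K ⟶ L) :
    Nonempty (Homotopy ((mapComplexAdjunction adj).homEquiv _ _ f)
      ((mapComplexAdjunction adj).homEquiv _ _ g)) ↔ Nonempty (Homotopy f g) := by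
  constructor
  · rintro ⟨h⟩
    rw [← ((mapComplexAdjunction adj).homEquiv _ _).symm_apply_apply f,
      ← ((mapComplexAdjunction adj).homEquiv _ _).symm_apply_apply g]
    rw [Adjunction.homEquiv_counit, Adjunction.homEquiv_counit]
    exact ⟨(F.mapHomotopy h).compRight _⟩
  · rintro ⟨h⟩
    rw [Adjunction.homEquiv_unit, Adjunction.homEquiv_unit]
    exact ⟨(G.mapHomotopy h).compLeft _⟩

/-- The left adjoint of an exact functor preserves K-projective complexes. -/
lemma isKProjective_of_adjunction (adj : F ⊣ G) [PreservesFiniteLimits G] [PreservesFiniteColimits G]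
    [K.IsKProjective] :
    CochainComplex.IsKProjective ((F.mapHomologicalComplex (ComplexShape.up ℤ)).obj K) where
  nonempty_homotopy_zero {L} f hL := by
    rw [← nonempty_homotopy_homEquiv_iff adj]
    have : Nonempty (Homotopy ((mapComplexAdjunction adj).homEquiv _ _ f) 0) :=
      IsKProjective.nonempty_homotopy_zero _ fun n => (hL n).map _
    have h0 : (mapComplexAdjunction adj).homEquiv _ _
        (0 : (F.mapHomologicalComplex (ComplexShape.up ℤ)).obj K ⟶ L) = 0 := by
      rw [Adjunction.homEquiv_unit, Functor.map_zero, comp_zero]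
    rwa [h0]

end Complexes

section Derived

open DerivedCategory

variable {𝓐 : Type u₁} [Category.{v₁} 𝓐] [Abelian 𝓐] [HasDerivedCategory.{w₁} 𝓐]
  {K L : CochainComplex 𝓐 ℤ}

/-- The hypothesis holds when the source is K-projective or the target K-injective; both cases occur
in `bijective_derivedHomMap`. -/
lemma exists_Q_map_eq_of_bijective
    (h : Function.Bijective (DerivedCategory.Qh.map :
      ((HomotopyCategory.quotient 𝓐 (ComplexShape.up ℤ)).obj K ⟶
        (HomotopyCategory.quotient 𝓐 (ComplexShape.up ℤ)).obj L) → _)) (f : Q.obj K ⟶ Q.obj L) :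
    ∃ g : K ⟶ L, Q.map g = f := by
  obtain ⟨g, hg⟩ := h.surjective
    ((quotientCompQhIso 𝓐).hom.app K ≫ f ≫ (quotientCompQhIso 𝓐).inv.app L)
  obtain ⟨g, rfl⟩ := (HomotopyCategory.quotient 𝓐 (ComplexShape.up ℤ)).map_surjective g
  refine ⟨g, ?_⟩
  rw [← cancel_epi ((quotientCompQhIso 𝓐).hom.app K), ← quotientCompQhIso_hom_naturality, hg]
  simp

lemma nonempty_homotopy_of_bijective
    (h : Function.Bijective (DerivedCategory.Qh.map :
      ((HomotopyCategory.quotient 𝓐 (ComplexShape.up ℤ)).obj K ⟶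
        (HomotopyCategory.quotient 𝓐 (ComplexShape.up ℤ)).obj L) → _)) {f g : K ⟶ L}
    (hfg : Q.map f = Q.map g) : Nonempty (Homotopy f g) := by
  refine ⟨HomotopyCategory.homotopyOfEq _ _ (h.injective ?_)⟩
  rw [← cancel_mono ((quotientCompQhIso 𝓐).hom.app L), quotientCompQhIso_hom_naturality,
    quotientCompQhIso_hom_naturality, hfg]

lemma Q_map_eq_of_homotopy {f g : K ⟶ L} (h : Nonempty (Homotopy f g)) : Q.map f = Q.map g := by
  rw [← cancel_epi ((quotientCompQhIso 𝓐).hom.app K), ← quotientCompQhIso_hom_naturality,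
    ← quotientCompQhIso_hom_naturality, HomotopyCategory.eq_of_homotopy _ _ h.some]

end Derived

section TwoAdjunctions

open DerivedCategory

variable {𝓐 : Type u₁} {𝓑 : Type u₂} {𝓒 : Type u₃} [Category.{v₁} 𝓐] [Category.{v₂} 𝓑]
  [Category.{v₃} 𝓒] [Abelian 𝓐] [Abelian 𝓑] [Abelian 𝓒] [HasDerivedCategory.{w₂} 𝓑]
  [HasDerivedCategory.{w₃} 𝓒] {a : 𝓐 ⥤ 𝓑} {ι : 𝓑 ⥤ 𝓐} {L : 𝓑 ⥤ 𝓒} {R : 𝓒 ⥤ 𝓑}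
  (adj' : L ⊣ R) [a.Additive] [ι.Additive] [L.Additive] [R.Additive] [PreservesFiniteLimits R]
  [PreservesFiniteColimits R]

/-- The map of morphisms in derived categories induced by the unit of an adjunction `L ⊣ R` on
complexes, where `R` is exact. -/
def derivedHomMap (M : CochainComplex 𝓑 ℤ) (Z : DerivedCategory 𝓒)
    (g : Q.obj ((L.mapHomologicalComplex (ComplexShape.up ℤ)).obj M) ⟶ Z) :
    Q.obj M ⟶ R.mapDerivedCategory.obj Z :=
  (Q.map ((mapComplexAdjunction adj').unit.app M) ≫ R.mapDerivedCategoryFactors.inv.app _) ≫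
    R.mapDerivedCategory.map g

lemma derivedHomMap_Q_map {M : CochainComplex 𝓑 ℤ} {G : CochainComplex 𝓒 ℤ}
    (g : (L.mapHomologicalComplex (ComplexShape.up ℤ)).obj M ⟶ G) :
    derivedHomMap adj' M _ (Q.map g) ≫ R.mapDerivedCategoryFactors.hom.app G =
      Q.map ((mapComplexAdjunction adj').homEquiv _ _ g) := by
  rw [derivedHomMap, Adjunction.homEquiv_unit, Functor.map_comp, Category.assoc, Category.assoc,
    Functor.mapDerivedCategoryFactors_hom_naturality]
  simp

lemma bijective_derivedHomMap_of_iso (M : CochainComplex 𝓑 ℤ) {Z Z' : DerivedCategory 𝓒}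
    (e : Z ≅ Z') (h : Function.Bijective (derivedHomMap adj' M Z)) :
    Function.Bijective (derivedHomMap adj' M Z') := by
  have : derivedHomMap adj' M Z' =
      (fun g => g ≫ R.mapDerivedCategory.map e.hom) ∘ derivedHomMap adj' M Z ∘
        (fun g => g ≫ e.inv) := by
    ext g
    simp [derivedHomMap, ← Functor.map_comp]
  rw [this]
  exact ((R.mapDerivedCategory.mapIso e).homToEquiv).bijective.comp
    (h.comp e.symm.homToEquiv.bijective)

/-- Every morphism group involved consists of homotopy classes of chain maps: by K-projectivity of
`K` and of its image under `L` after `a`, or by K-injectivity of `I`. The two adjunctions on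
complexes identify these classes. Right exactness of `ι` is not available, so `q` must be assumed to
stay a quasi-isomorphism under `ι`. -/
theorem bijective_derivedHomMap (adj : a ⊣ ι) {K : CochainComplex 𝓐 ℤ} [K.IsKProjective]
    [CochainComplex.IsKProjective ((L.mapHomologicalComplex (ComplexShape.up ℤ)).obj
      ((a.mapHomologicalComplex (ComplexShape.up ℤ)).obj K))]
    {G : CochainComplex 𝓒 ℤ} {I : CochainComplex 𝓑 ℤ} [I.IsKInjective]
    (q : (R.mapHomologicalComplex (ComplexShape.up ℤ)).obj G ⟶ I) [QuasiIso q]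
    [QuasiIso ((ι.mapHomologicalComplex (ComplexShape.up ℤ)).map q)] :
    Function.Bijective (derivedHomMap adj'
      ((a.mapHomologicalComplex (ComplexShape.up ℤ)).obj K) (Q.obj G)) := by
  let := HasDerivedCategory.standard 𝓐
  have hK := fun M => IsKProjective.Qh_map_bijective K
    ((HomotopyCategory.quotient _ _).obj M)
  have hI := fun M => IsKInjective.Qh_map_bijective
    ((HomotopyCategory.quotient _ _).obj M) I
  have hL := IsKProjective.Qh_map_bijective ((L.mapHomologicalComplex (ComplexShape.up ℤ)).obj
      ((a.mapHomologicalComplex (ComplexShape.up ℤ)).obj K))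
    ((HomotopyCategory.quotient _ _).obj G)
  let A := mapComplexAdjunction adj
  let A' := mapComplexAdjunction adj'
  have key (g : (L.mapHomologicalComplex (ComplexShape.up ℤ)).obj
      ((a.mapHomologicalComplex (ComplexShape.up ℤ)).obj K) ⟶ G) :
      A.homEquiv _ _ (A'.homEquiv _ _ g ≫ q) = A.homEquiv _ _ (A'.homEquiv _ _ g) ≫
        (ι.mapHomologicalComplex (ComplexShape.up ℤ)).map q :=
    A.homEquiv_naturality_right _ _
  constructor
  · intro g g' hg
    -- Injectivity: transport the equality to homotopies of maps into `I`, transpose along `adj`,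
    -- cancel the image of `q`, and transpose back.
    obtain ⟨g, rfl⟩ := exists_Q_map_eq_of_bijective hL g
    obtain ⟨g', rfl⟩ := exists_Q_map_eq_of_bijective hL g'
    have h₁ : Q.map (A'.homEquiv _ _ g ≫ q) = Q.map (A'.homEquiv _ _ g' ≫ q) := by
      rw [Functor.map_comp, Functor.map_comp, ← derivedHomMap_Q_map, ← derivedHomMap_Q_map, hg]
    have h₂ := nonempty_homotopy_of_bijective (hI _) h₁
    rw [← nonempty_homotopy_homEquiv_iff adj] at h₂
    have h₃ := Q_map_eq_of_homotopy h₂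
    change Q.map (A.homEquiv _ _ _) = Q.map (A.homEquiv _ _ _) at h₃
    rw [key, key, Functor.map_comp, Functor.map_comp, cancel_mono] at h₃
    have h₄ := nonempty_homotopy_of_bijective (hK _) h₃
    rw [nonempty_homotopy_homEquiv_iff, nonempty_homotopy_homEquiv_iff] at h₄
    exact Q_map_eq_of_homotopy h₄
  · intro f
    obtain ⟨f₀, hf₀⟩ := exists_Q_map_eq_of_bijective (hI _)
      (f ≫ R.mapDerivedCategoryFactors.hom.app G ≫ Q.map q)
    -- The transpose of `f₀` is divided by the image of `q`, and the quotient is a genuine chain map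
    -- since `K` is K-projective.
    obtain ⟨h, hh⟩ := exists_Q_map_eq_of_bijective (hK _) (Q.map (A.homEquiv _ _ f₀) ≫
      inv (Q.map ((ι.mapHomologicalComplex (ComplexShape.up ℤ)).map q)))
    obtain ⟨h, rfl⟩ := (A.homEquiv _ _).surjective h
    obtain ⟨g, rfl⟩ := (A'.homEquiv _ _).surjective h
    refine ⟨Q.map g, ?_⟩
    rw [← cancel_mono (R.mapDerivedCategoryFactors.hom.app G), ← cancel_mono (Q.map q),
      derivedHomMap_Q_map, ← Functor.map_comp, Category.assoc, ← hf₀]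
    refine Q_map_eq_of_homotopy ((nonempty_homotopy_homEquiv_iff adj _ _).1
      (nonempty_homotopy_of_bijective (hK _) ?_))
    change Q.map (A.homEquiv _ _ _) = Q.map (A.homEquiv _ _ _)
    rw [key, Functor.map_comp, hh]
    simp

end TwoAdjunctions

end Adjunction

/-! ### Objects of D(ℤ) are represented by complexes with zero differentials. -/

section Formality

open Opposite CochainComplex HomologicalComplex

universe v v₁

/-- Injective abelian groups are the divisible ones, and divisibility passes to quotients: to divide
`x` by `n`, extend 1 ↦ `x` along multiplication by `n` on ℤ. -/
lemma injective_of_epi {J J' : AddCommGrpCat.{u}} (f : J ⟶ J') [Epi f] [Injective J] :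
    Injective J' := by
  let : DivisibleBy J' ℤ := divisibleByOfSMulRightSurj J' ℤ fun {n} hn y => by
    obtain ⟨x, rfl⟩ := (AddCommGrpCat.epi_iff_surjective f).1 inferInstance y
    let i : AddCommGrpCat.of (ULift.{u} ℤ) ⟶ AddCommGrpCat.of (ULift.{u} ℤ) :=
      AddCommGrpCat.ofHom (zsmulAddGroupHom n)
    have : Mono i := (AddCommGrpCat.mono_iff_injective i).2 fun a b hab =>
      ULift.down_injective (mul_left_cancel₀ hn (congrArg ULift.down hab))
    let t : AddCommGrpCat.of (ULift.{u} ℤ) ⟶ J := AddCommGrpCat.ofHom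
      ((zmultiplesHom J x).comp AddEquiv.ulift.toAddMonoidHom)
    let g := Injective.factorThru t i
    refine ⟨f (g ⟨1⟩), ?_⟩
    have h₁ : g (i ⟨1⟩) = t ⟨1⟩ := ConcreteCategory.congr_hom (Injective.comp_factorThru t i) ⟨1⟩
    have h₂ : t ⟨1⟩ = x := one_zsmul x
    have h₃ : i ⟨1⟩ = n • (⟨1⟩ : ULift.{u} ℤ) := rfl
    change n • f (g ⟨1⟩) = f x
    rw [← h₂, ← h₁, h₃, map_zsmul, map_zsmul]
  exact AddCommGrpCat.injective_of_divisible J'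

/-- Subgroups of projective abelian groups are projective. -/
lemma projective_of_mono {A B : AddCommGrpCat.{u}} (i : A ⟶ B) [Mono i] [Projective B] :
    Projective A where
  factors {N N'} f p _ := by
    -- Embed `N` in an injective `E`. Then `N'` embeds in `E / ker p`, still injective, so `f`
    -- extends to `B`, and the extension lifts to `E` as `B` is projective. The restriction of this
    -- lift to `A` vanishes in `E / N`, so it lands in `N`.
    let k : N ⟶ Injective.under N := Injective.ι N
    let π := cokernel.π (kernel.ι p ≫ k)
    have : Injective (cokernel (kernel.ι p ≫ k)) := injective_of_epi π
    have hp : IsColimit (CokernelCofork.ofπ p (kernel.condition p)) :=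
      Abelian.epiIsCokernelOfKernel (KernelFork.ofι _ (kernel.condition p)) (kernelIsKernel p)
    let k' : N' ⟶ cokernel (kernel.ι p ≫ k) := Cofork.IsColimit.desc hp (k ≫ π) (by
      rw [zero_comp, ← Category.assoc]
      exact cokernel.condition _)
    have hk' : p ≫ k' = k ≫ π := Cofork.IsColimit.π_desc' hp _ _
    let g : B ⟶ cokernel (kernel.ι p ≫ k) := Injective.factorThru (f ≫ k') i
    let g' : B ⟶ Injective.under N := Projective.factorThru g π
    have hg : i ≫ g' ≫ π = f ≫ k' := by
      rw [Projective.factorThru_comp, Injective.comp_factorThru]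
    let s : cokernel (kernel.ι p ≫ k) ⟶ cokernel k := cokernel.desc _ (cokernel.π k) (by simp)
    have hs : π ≫ s = cokernel.π k := cokernel.π_desc _ _ _
    have hk's : k' ≫ s = 0 := by
      rw [← cancel_epi p, ← Category.assoc, hk', Category.assoc, hs, cokernel.condition, comp_zero]
    let l : A ⟶ N := Abelian.monoLift k (i ≫ g') (by
      rw [← hs, Category.assoc, ← Category.assoc g', ← Category.assoc i, hg, Category.assoc, hk's,
        comp_zero])
    have hl : l ≫ k = i ≫ g' := Abelian.monoLift_comp _ _ _
    have hmono : Mono k' := Preadditive.mono_of_cancel_zero _ fun {T} z hz => by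
      obtain ⟨T', t, _, y, hy⟩ := surjective_up_to_refinements_of_epi p z
      have hyk : (y ≫ k) ≫ π = 0 := by
        rw [Category.assoc, ← hk', ← Category.assoc, ← hy, Category.assoc, hz, comp_zero]
      have : y = Abelian.monoLift (kernel.ι p ≫ k) (y ≫ k) hyk ≫ kernel.ι p := by
        rw [← cancel_mono k, Category.assoc, Abelian.monoLift_comp]
      rw [← cancel_epi t, hy, this, Category.assoc, kernel.condition, comp_zero, comp_zero]
    refine ⟨l, ?_⟩
    rw [← cancel_mono k', Category.assoc, hk', ← Category.assoc, hl, Category.assoc, hg]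

section

variable {𝓒 : Type v₁} [Category.{v} 𝓒] [Abelian 𝓒]

lemma quasiIso_of_iCycles_comp_eq {K H : CochainComplex 𝓒 ℤ} (hd : ∀ i j, H.d i j = 0)
    (φ : K ⟶ H) (e : ∀ n, K.homology n ≅ H.X n)
    (he : ∀ n, K.iCycles n ≫ φ.f n = K.homologyπ n ≫ (e n).hom) : QuasiIso φ where
  quasiIsoAt n := by
    rw [quasiIsoAt_iff_isIso_homologyMap]
    have h₁ : IsIso (H.iCycles n) := H.isIso_iCycles n (n + 1) (by simp) (hd _ _)
    have h₂ : IsIso (H.homologyπ n) := H.isIso_homologyπ (n - 1) n (by simp) (hd _ _)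
    have : homologyMap φ n ≫ inv (H.homologyπ n) ≫ H.iCycles n = (e n).hom := by
      rw [← cancel_epi (K.homologyπ n), homologyπ_naturality_assoc, IsIso.hom_inv_id_assoc,
        cyclesMap_i, he]
    exact IsIso.of_isIso_fac_right this

/-- Retract to cycles and project to homology: boundaries die, so this is a chain map to the
homology with zero differential. -/
lemma exists_hom_of_retraction {K : CochainComplex 𝓒 ℤ} (r : ∀ n, K.X n ⟶ K.cycles n)
    (hr : ∀ n, K.iCycles n ≫ r n = 𝟙 _) :
    ∃ (H : CochainComplex 𝓒 ℤ) (φ : K ⟶ H), (∀ i j, H.d i j = 0) ∧ QuasiIso φ := by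
  refine ⟨{ X := fun n => K.homology n, d := fun _ _ => 0 },
    { f := fun n => r n ≫ K.homologyπ n
      comm' := fun i j _ => ?_ }, fun _ _ => rfl,
    quasiIso_of_iCycles_comp_eq (fun _ _ => rfl) _ (fun _ => Iso.refl _) fun n => ?_⟩
  · refine comp_zero.trans ?_
    change 0 = K.d i j ≫ r j ≫ K.homologyπ j
    rw [← K.toCycles_i i j, Category.assoc, ← Category.assoc (K.iCycles j), hr, Category.id_comp,
      toCycles_comp_homologyπ]
  · change K.iCycles n ≫ r n ≫ K.homologyπ n = K.homologyπ n ≫ 𝟙 _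
    rw [← Category.assoc, hr, Category.id_comp, Category.comp_id]

end

/-- A complex of projective abelian groups is quasi-isomorphic to a complex with zero
differentials. -/
lemma exists_quasiIso_of_projective (K : CochainComplex AddCommGrpCat.{u} ℤ)
    [∀ n, Projective (K.X n)] :
    ∃ (H : CochainComplex AddCommGrpCat.{u} ℤ) (φ : K ⟶ H),
      (∀ i j, H.d i j = 0) ∧ QuasiIso φ := by
  have hr (n : ℤ) : ∃ r : K.X n ⟶ K.cycles n, K.iCycles n ≫ r = 𝟙 _ := by
    let S := ShortComplex.mk (K.iCycles n) (K.d n (n + 1)) (K.iCycles_d n (n + 1))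
    have hS : S.Exact := S.exact_of_f_is_kernel (K.cyclesIsKernel n (n + 1) (by simp))
    have : Mono (cokernel.desc S.f S.g S.zero) := hS.mono_cokernelDesc
    -- The quotient by the cycles embeds in the next term, so it is projective and the cycles split
    -- off.
    have : Projective (cokernel (K.iCycles n)) := projective_of_mono (cokernel.desc S.f S.g S.zero)
    let T := ShortComplex.mk (K.iCycles n) (cokernel.π (K.iCycles n)) (cokernel.condition _)
    have hT : T.ShortExact :=
      { exact := T.exact_of_g_is_cokernel (cokernelIsCokernel _)
        mono_f := inferInstanceAs (Mono (K.iCycles n))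
        epi_g := inferInstanceAs (Epi (cokernel.π _)) }
    exact ⟨hT.splittingOfProjective.r, hT.splittingOfProjective.f_r⟩
  choose r hr using hr
  exact exists_hom_of_retraction r hr

/-- The infinite cyclic group is a compact projective separator. -/
instance : IsCompactProjectiveFamily
    (fun _ : PUnit.{u + 1} => AddCommGrpCat.free.{u}.obj PUnit.{u + 1}) :=
  IsCompactProjectiveFamily.of_iso (G := fun _ => 𝟭 _)
    (fun _ => NatIso.ofComponents
      (fun A => ((AddCommGrpCat.adj.homEquiv PUnit.{u + 1} A).trans
        { toFun := fun f => f PUnit.unit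
          invFun := fun x => ↾fun _ => x
          left_inv := fun _ => rfl
          right_inv := fun _ => rfl }).toIso)
      (fun {A B} f => by
        ext x
        rfl))
    (fun f g h => h ⟨⟩)

/-- Every object of the derived category of abelian groups is represented by a complex with zero
differentials. -/
lemma exists_iso_Q_of_zero_d [HasDerivedCategory.{w} AddCommGrpCat.{u}]
    (Z : DerivedCategory AddCommGrpCat.{u}) :
    ∃ H : CochainComplex AddCommGrpCat.{u} ℤ, (∀ i j, H.d i j = 0) ∧
      Nonempty (DerivedCategory.Q.obj H ≅ Z) := by
  let P := fun _ : PUnit.{u + 1} => AddCommGrpCat.free.{u}.obj PUnit.{u + 1}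
  let G := DerivedCategory.Q.objPreimage Z
  have (n : ℤ) : Projective (((semifree P).obj G).X n) := by
    obtain ⟨κ, i, ⟨e⟩⟩ := exists_semifree_X_iso (P := P) G n
    exact Projective.of_iso e.symm inferInstance
  obtain ⟨H, φ, hH, _⟩ := exists_quasiIso_of_projective ((semifree P).obj G)
  exact ⟨H, hH, ⟨(asIso (DerivedCategory.Q.map φ)).symm ≪≫
    asIso (DerivedCategory.Q.map ((semifreeπ P).app G)) ≪≫ DerivedCategory.Q.objObjPreimageIso Z⟩⟩

end Formality

/-! ### Free presheaves on representables as compact projective generators. -/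

section FreePresheaf

open Opposite

variable {B : Type u} [SmallCategory B]

/-- The free presheaf of abelian groups on a representable presheaf. -/
abbrev freeYoneda (U : B) : Bᵒᵖ ⥤ AddCommGrpCat.{u} := yoneda.obj U ⋙ AddCommGrpCat.free

/-- The free presheaf on a representable presheaf corepresents evaluation. -/
def coyonedaFreeYoneda (U : B) :
    coyoneda.obj (op (freeYoneda U)) ≅
      (evaluation Bᵒᵖ AddCommGrpCat.{u}).obj (op U) ⋙ forget AddCommGrpCat.{u} :=
  NatIso.ofComponents
    (fun M => (((AddCommGrpCat.adj.whiskerRight Bᵒᵖ).homEquiv (yoneda.obj U) M).trans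
      yonedaEquiv).toIso)
    (fun {M N} f => by
      ext x
      rfl)

/-- Evaluations of presheaves preserve epimorphisms and colimits, and are jointly faithful. -/
instance : IsCompactProjectiveFamily (fun U : B => freeYoneda U) :=
  IsCompactProjectiveFamily.of_iso coyonedaFreeYoneda
    (fun f g h => by
      ext1
      ext1 U
      exact h U.unop)

end FreePresheaf

/-! ### Sheaves on X as a reflective subcategory of presheaves on a basis. -/

section DenseSubsite

variable {X : TopCat.{u}} {B : Type u} [SmallCategory B] (F : B ⥤ Opens X) [F.Full] [F.Faithful]
  [F.IsCoverDense (Opens.grothendieckTopology X)]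

/-- The restriction of sheaves on `X` to presheaves on a basis. -/
def restrictToBasis : AbSheaf X ⥤ Bᵒᵖ ⥤ AddCommGrpCat.{u} :=
  F.sheafPushforwardContinuous AddCommGrpCat.{u}
    (F.restrictedTopology (Opens.grothendieckTopology X)) (Opens.grothendieckTopology X) ⋙
    sheafToPresheaf _ _

/-- The sheaf on `X` associated to a presheaf on a basis. -/
def sheafOfBasis : (Bᵒᵖ ⥤ AddCommGrpCat.{u}) ⥤ AbSheaf X :=
  presheafToSheaf (F.restrictedTopology (Opens.grothendieckTopology X)) AddCommGrpCat.{u} ⋙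
    (F.sheafPushforwardContinuous AddCommGrpCat.{u}
      (F.restrictedTopology (Opens.grothendieckTopology X)) (Opens.grothendieckTopology X)).inv

/-- Passing to the associated sheaf is left adjoint to restriction to a basis. -/
def basisAdjunction : sheafOfBasis F ⊣ restrictToBasis F :=
  (sheafificationAdjunction _ _).comp (Functor.asEquivalence _).symm.toAdjunction

instance : (restrictToBasis F).Full := Functor.Full.comp _ _
instance : (restrictToBasis F).Faithful := Functor.Faithful.comp _ _
instance : PreservesFiniteLimits (sheafOfBasis F) := comp_preservesFiniteLimits _ _
instance : PreservesFiniteColimits (sheafOfBasis F) where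
  preservesFiniteColimits _ _ _ :=
    have := (basisAdjunction F).leftAdjoint_preservesColimits.{0, 0}
    inferInstance
instance : (sheafOfBasis F).Additive := Functor.additive_of_preserves_binary_products _
instance : (restrictToBasis F).Additive := (basisAdjunction F).right_adjoint_additive

end DenseSubsite

/-! ### Sections of constant sheaves over connected opens; existence of cosections. -/

section ConstantSections

open Opposite

variable {X : TopCat.{u}}

/-- The map from an abelian group to the sections of the associated constant sheaf. -/
def toPiInv (G : AddCommGrpCat.{u}) :
    (Functor.const (Opens X)ᵒᵖ).obj G ⟶ ((piInv X).obj G).obj :=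
  toSheafify (Opens.grothendieckTopology X) ((Functor.const (Opens X)ᵒᵖ).obj G)

instance (G : AddCommGrpCat.{u}) :
    Presheaf.IsLocallyInjective (Opens.grothendieckTopology X) (toPiInv (X := X) G) :=
  inferInstanceAs (Presheaf.IsLocallyInjective _ (toSheafify _ _))

instance (G : AddCommGrpCat.{u}) :
    Presheaf.IsLocallySurjective (Opens.grothendieckTopology X) (toPiInv (X := X) G) :=
  inferInstanceAs (Presheaf.IsLocallySurjective _ (toSheafify _ _))

/-- Two elements with the same section agree in the constant presheaf near any point, and there
restriction maps are identities. -/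
lemma toPiInv_app_injective (G : AddCommGrpCat.{u}) {U : Opens X} (hU : (U : Set X).Nonempty) :
    Function.Injective ((toPiInv (X := X) G).app (op U)) := by
  intro g g' h
  obtain ⟨x, hx⟩ := hU
  obtain ⟨V, i, hi, -⟩ := Presheaf.equalizerSieve_mem (Opens.grothendieckTopology X)
    (toPiInv (X := X) G) g g' h x hx
  exact hi

lemma map_toPiInv_app (G : AddCommGrpCat.{u}) {U V : Opens X} (i : V ⟶ U) (g : G) :
    ((piInv X).obj G).obj.map i.op ((toPiInv (X := X) G).app (op U) g) =
      (toPiInv (X := X) G).app (op V) g :=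
  (ConcreteCategory.congr_hom ((toPiInv (X := X) G).naturality i.op) g).symm

lemma exists_subset_of_isConnected {Y ι : Type*} [TopologicalSpace Y] {S : Set Y}
    (hS : IsConnected S) (W : ι → Set Y) (hW : ∀ g, IsOpen (W g)) (hcov : ∀ x ∈ S, ∃ g, x ∈ W g)
    (hdisj : ∀ x g g', x ∈ W g → x ∈ W g' → g = g') : ∃ g, S ⊆ W g := by
  obtain ⟨x₀, hx₀⟩ := hS.nonempty
  obtain ⟨g₀, hg₀⟩ := hcov x₀ hx₀
  refine ⟨g₀, ?_⟩
  by_contra hne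
  obtain ⟨y, hy, hy'⟩ := Set.not_subset.1 hne
  have hcov' : S ⊆ W g₀ ∪ ⋃ g : {g : ι // g ≠ g₀}, W g.1 := by
    intro z hz
    obtain ⟨g, hg⟩ := hcov z hz
    by_cases h : g = g₀
    · exact Or.inl (h ▸ hg)
    · exact Or.inr (Set.mem_iUnion.2 ⟨⟨g, h⟩, hg⟩)
  obtain ⟨z, -, hz, hz'⟩ := hS.isPreconnected _ _ (hW g₀) (isOpen_iUnion fun g : {g // g ≠ g₀} => hW g.1)
    hcov'
    ⟨x₀, hx₀, hg₀⟩ ⟨y, hy, (hcov' hy).resolve_left hy'⟩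
  obtain ⟨⟨g, hg⟩, hz'⟩ := Set.mem_iUnion.1 hz'
  exact hg (hdisj z _ _ hz' hz)

/-- A section of a constant sheaf over a connected open subset is constant. -/
lemma toPiInv_app_surjective (G : AddCommGrpCat.{u}) {U : Opens X}
    (hU : IsConnected (U : Set X)) : Function.Surjective ((toPiInv (X := X) G).app (op U)) := by
  intro s
  let T (g : G) (V : Opens X) : Prop := ∃ i : V ⟶ U,
    (toPiInv (X := X) G).app (op V) g = ((piInv X).obj G).obj.map i.op s
  have hT (g : G) {V V' : Opens X} (j : V' ⟶ V) (h : T g V) : T g V' := by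
    obtain ⟨i, hi⟩ := h
    refine ⟨j ≫ i, ?_⟩
    rw [← map_toPiInv_app G j, hi, op_comp, Functor.map_comp, ConcreteCategory.comp_apply]
  -- The sets where `s` is locally equal to `g` are open and cover `U`; they are disjoint by
  -- injectivity over non-empty opens. Connectedness leaves a single `g`.
  obtain ⟨g, hg⟩ := exists_subset_of_isConnected hU
    (fun g => {x : X | ∃ V : Opens X, T g V ∧ x ∈ V})
    (fun g => isOpen_iff_forall_mem_open.2 fun x ⟨V, hV, hx⟩ =>
      ⟨V, fun y hy => ⟨V, hV, hy⟩, V.isOpen, hx⟩)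
    (fun x hx => by
      obtain ⟨V, i, ⟨g, hg⟩, hV⟩ :=
        Presheaf.imageSieve_mem (Opens.grothendieckTopology X) (toPiInv (X := X) G) s x hx
      exact ⟨g, V, ⟨i, hg⟩, hV⟩)
    (fun x g g' => by
      rintro ⟨V, hV, hx⟩ ⟨V', hV', hx'⟩
      obtain ⟨i, hi⟩ := hT g (Opens.infLELeft V V') hV
      obtain ⟨i', hi'⟩ := hT g' (Opens.infLERight V V') hV'
      refine toPiInv_app_injective G (U := V ⊓ V') ⟨x, hx, hx'⟩ ?_
      rw [hi, hi', Subsingleton.elim i i'])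
  refine ⟨g, TopCat.Sheaf.eq_of_locally_eq' (F := (piInv X).obj G)
    (fun V : {V : Opens X // T g V} => V.1) U (fun V => V.2.choose) ?_ _ _ fun V =>
    (map_toPiInv_app G _ _).trans V.2.choose_spec⟩
  intro z hz
  obtain ⟨V, hV, hz⟩ := hg hz
  exact Opens.mem_iSup.2 ⟨⟨V, hV⟩, hz⟩

lemma isIso_toPiInv_app (G : AddCommGrpCat.{u}) {U : Opens X} (hU : IsConnected (U : Set X)) :
    IsIso ((toPiInv (X := X) G).app (op U)) := by
  rw [ConcreteCategory.isIso_iff_bijective]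
  exact ⟨toPiInv_app_injective G hU.nonempty, toPiInv_app_surjective G hU⟩

variable {B : Type u} [SmallCategory B] (F : B ⥤ Opens X) [F.Full] [F.Faithful]
  [F.IsCoverDense (Opens.grothendieckTopology X)]

/-- Constant sheaves restrict to constant presheaves on a basis of connected open subsets. -/
def piInvCompRestrictToBasis (hF : ∀ b, IsConnected (F.obj b : Set X)) :
    Functor.const Bᵒᵖ ≅ piInv X ⋙ restrictToBasis F :=
  NatIso.ofComponents
    (fun G => NatIso.ofComponents
      (fun b => @asIso _ _ _ _ ((toPiInv (X := X) G).app (op (F.obj b.unop)))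
        (isIso_toPiInv_app G (hF b.unop)))
      (fun {b b'} f => (toPiInv (X := X) G).naturality (F.map f.unop).op))
    (fun {G G'} f => by
      ext1
      ext1 b
      have := toSheafify_naturality (Opens.grothendieckTopology X)
        ((Functor.const (Opens X)ᵒᵖ).map f)
      exact congr_app this (op (F.obj b.unop)))

/-- The constant sheaf functor has a left adjoint if there is a basis of connected open
subsets. -/
lemma isRightAdjoint_piInv (hF : ∀ b, IsConnected (F.obj b : Set X)) :
    (piInv X).IsRightAdjoint := by
  have : HasColimitsOfSize.{u, u} AddCommGrpCat.{u} := inferInstance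
  let adj : colim (J := Bᵒᵖ) (C := AddCommGrpCat.{u}) ⊣ piInv X ⋙ restrictToBasis F :=
    (colimConstAdj).ofNatIsoRight (piInvCompRestrictToBasis F hF)
  -- As restriction to the basis is fully faithful, the colimit of the restricted presheaf is
  -- already left adjoint to `piInv X`.
  exact ⟨_, ⟨adj.restrictFullyFaithful (Functor.FullyFaithful.ofFullyFaithful (restrictToBasis F))
    (Functor.FullyFaithful.id _) (D := AddCommGrpCat.{u})
    (L := restrictToBasis F ⋙ colim) (Functor.rightUnitor _).symm (Functor.leftUnitor _)⟩⟩

end ConstantSections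

/-! ### Comparison of Ext vanishing along an exact functor. -/

section ExtComparison

open Opposite Abelian

universe v₁ u₁ u₂ w₁ w₂

variable {𝓐 : Type u₁} {𝓑 : Type u₂} [Category.{v₁} 𝓐] [Category.{v₁} 𝓑] [Abelian 𝓐] [Abelian 𝓑]
  [HasExt.{w₁} 𝓐] [HasExt.{w₂} 𝓑]

lemma subsingleton_ext_one_iff (A : 𝓐) {S : ShortComplex 𝓐} (hS : S.ShortExact)
    [Injective S.X₂] :
    Subsingleton (Ext.{w₁} A S.X₁ 1) ↔ ∀ f : A ⟶ S.X₃, ∃ g : A ⟶ S.X₂, g ≫ S.g = f := by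
  constructor
  · intro _ f
    obtain ⟨x, hx⟩ := Ext.covariant_sequence_exact₃ A hS (Ext.mk₀ f) (zero_add 1)
      (Subsingleton.elim _ _)
    obtain ⟨g, rfl⟩ := (Ext.mk₀_bijective _ _).surjective x
    refine ⟨g, (Ext.mk₀_bijective _ _).injective ?_⟩
    rw [← hx, Ext.mk₀_comp_mk₀]
  · intro h
    refine subsingleton_of_forall_eq 0 fun x => ?_
    obtain ⟨y, rfl⟩ := Ext.covariant_sequence_exact₁ A hS x (Ext.eq_zero_of_injective _)
      (zero_add 1)
    obtain ⟨f, rfl⟩ := (Ext.mk₀_bijective _ _).surjective y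
    obtain ⟨g, rfl⟩ := h f
    rw [← Ext.mk₀_comp_mk₀, Ext.comp_assoc _ _ _ (add_zero 0) (zero_add 1) (by lia),
      hS.comp_extClass, Ext.comp_zero]

/-- Dimension shifting: the positive Ext groups into the injective middle term vanish. -/
lemma subsingleton_ext_succ_iff (A : 𝓐) {S : ShortComplex 𝓐} (hS : S.ShortExact)
    [Injective S.X₂] (n : ℕ) :
    Subsingleton (Ext.{w₁} A S.X₁ (n + 2)) ↔ Subsingleton (Ext.{w₁} A S.X₃ (n + 1)) := by
  constructor
  · intro _
    refine subsingleton_of_forall_eq 0 fun x => ?_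
    obtain ⟨y, rfl⟩ := Ext.covariant_sequence_exact₃ A hS x rfl (Subsingleton.elim _ _)
    rw [Ext.eq_zero_of_injective y, Ext.zero_comp]
  · intro _
    refine subsingleton_of_forall_eq 0 fun x => ?_
    obtain ⟨y, rfl⟩ := Ext.covariant_sequence_exact₁ A hS x (Ext.eq_zero_of_injective _)
      (show n + 1 + 1 = n + 2 from rfl)
    rw [Subsingleton.elim y 0, Ext.zero_comp]

/-- Vanishing of `Ext` groups can be checked after applying an exact functor which preserves
injective objects and is compatible with the given corepresentable functors. -/
theorem subsingleton_ext_iff [EnoughInjectives 𝓐] (T : 𝓐 ⥤ 𝓑) [T.Additive]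
    [PreservesFiniteLimits T] [PreservesFiniteColimits T] [T.PreservesInjectiveObjects]
    {A : 𝓐} {B : 𝓑} (e : coyoneda.obj (op A) ≅ T ⋙ coyoneda.obj (op B)) (n : ℕ) (F : 𝓐) :
    Subsingleton (Ext.{w₁} A F (n + 1)) ↔ Subsingleton (Ext.{w₂} B (T.obj F) (n + 1)) := by
  induction n generalizing F with
  | zero =>
    let S := ShortComplex.mk (Injective.ι F) (cokernel.π (Injective.ι F)) (cokernel.condition _)
    have hS : S.ShortExact := { exact := ShortComplex.exact_cokernel _ }
    -- `T` keeps the sequence exact and its middle term injective, so dimension shifting runs in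
    -- parallel on both sides and ends at Hom, where `e` applies.
    have : Injective S.X₂ := inferInstanceAs (Injective (Injective.under F))
    have : Injective (S.map T).X₂ := Functor.PreservesInjectiveObjects.injective_obj this
    refine (subsingleton_ext_one_iff A hS).trans
      (Iff.trans ?_ (subsingleton_ext_one_iff B (hS.map_of_exact T)).symm)
    have he (g : A ⟶ S.X₂) : e.hom.app S.X₃ (g ≫ S.g) = e.hom.app S.X₂ g ≫ T.map S.g :=
      ConcreteCategory.congr_hom (e.hom.naturality S.g) g
    have hbij (Y : 𝓐) : Function.Bijective (e.hom.app Y) := (e.app Y).toEquiv.bijective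
    constructor
    · intro h f
      obtain ⟨f, rfl⟩ := (hbij S.X₃).surjective f
      obtain ⟨g, rfl⟩ := h f
      exact ⟨_, (he g).symm⟩
    · intro h f
      obtain ⟨g, hg⟩ := h (e.hom.app S.X₃ f)
      obtain ⟨g, rfl⟩ := (hbij S.X₂).surjective g
      exact ⟨g, (hbij S.X₃).injective ((he g).trans hg)⟩
  | succ n hn =>
    let S := ShortComplex.mk (Injective.ι F) (cokernel.π (Injective.ι F)) (cokernel.condition _)
    have hS : S.ShortExact := { exact := ShortComplex.exact_cokernel _ }
    have : Injective S.X₂ := inferInstanceAs (Injective (Injective.under F))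
    have : Injective (S.map T).X₂ := Functor.PreservesInjectiveObjects.injective_obj this
    exact (subsingleton_ext_succ_iff A hS n).trans
      ((hn S.X₃).trans (subsingleton_ext_succ_iff B (hS.map_of_exact T) n).symm)

lemma subsingleton_ext_of_retract {A A' : 𝓐} (r : Retract A' A) (F : 𝓐) (n : ℕ)
    [Subsingleton (Ext.{w₁} A F n)] : Subsingleton (Ext.{w₁} A' F n) := by
  refine subsingleton_of_forall_eq 0 fun x => ?_
  rw [← Ext.mk₀_id_comp x, ← r.retract, ← Ext.mk₀_comp_mk₀,
    Ext.comp_assoc _ _ _ (add_zero 0) (zero_add n) (by lia),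
    Subsingleton.elim ((Ext.mk₀ r.r).comp x (zero_add n)) 0, Ext.comp_zero]

lemma subsingleton_ext_of_iso {A F F' : 𝓐} (e : F ≅ F') (n : ℕ)
    [Subsingleton (Ext.{w₁} A F n)] : Subsingleton (Ext.{w₁} A F' n) := by
  refine subsingleton_of_forall_eq 0 fun x => ?_
  rw [← Ext.comp_mk₀_id x, ← e.inv_hom_id, ← Ext.mk₀_comp_mk₀,
    ← Ext.comp_assoc _ _ _ (add_zero n) (add_zero 0) (by lia),
    Subsingleton.elim (x.comp (Ext.mk₀ e.inv) (add_zero n)) 0, Ext.zero_comp]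

end ExtComparison

/-! ### Left Kan extension of presheaves and monomorphisms. -/

section Lan

variable {C : Type u} [SmallCategory C] {D : Type u} [SmallCategory D] (L : C ⥤ D)

/-- Extension by zero of presheaves preserves monomorphisms. -/
lemma mono_lan_map [L.Full] [L.Faithful]
    (hL : ∀ d, (∃ c, Nonempty (L.obj c ≅ d)) ∨ IsEmpty (CostructuredArrow L d))
    {P P' : C ⥤ AddCommGrpCat.{u}} (f : P ⟶ P') [Mono f] : Mono (L.lan.map f) := by
  rw [NatTrans.mono_iff_mono_app]
  intro d
  -- On the image of `L` the unit is an isomorphism, so the map is `f` itself; elsewhere the value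
  -- is a colimit over an empty category, hence zero.
  obtain ⟨c, ⟨e⟩⟩ | h := hL d
  · have h₁ : Mono ((L.lan.map f).app (L.obj c)) := by
      have h := congr_app (L.lanUnit.naturality f) c
      have h₂ : Mono (f.app c) := inferInstance
      have h₃ (P : C ⥤ AddCommGrpCat.{u}) : IsIso ((L.lanUnit.app P).app c) := inferInstance
      have h' : f.app c ≫ (L.lanUnit.app P').app c =
        (L.lanUnit.app P).app c ≫ (L.lan.map f).app (L.obj c) := h
      rw [← IsIso.inv_comp_eq] at h'
      rw [← h']
      infer_instance
    have : (L.lan.map f).app d = inv ((L.lan.obj P).map e.hom) ≫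
        (L.lan.map f).app (L.obj c) ≫ (L.lan.obj P').map e.hom := by simp
    rw [this]
    infer_instance
  · have h₀ := Functor.isPointwiseLeftKanExtensionLeftKanExtensionUnit L P d
    have hz : IsZero ((L.lan.obj P).obj d) := by
      refine (isZero_zero AddCommGrpCat).of_iso (IsInitial.uniqueUpToIso ?_ HasZeroObject.zeroIsInitial)
      exact IsInitial.ofUniqueHom (fun Y => h₀.desc ⟨Y, { app := fun j => isEmptyElim j, naturality := fun j => isEmptyElim j }⟩)
        (fun Y m => h₀.hom_ext fun j => isEmptyElim j)
    exact hz.mono _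

end Lan

/-! ### Restriction to an open subset, extension by zero, and ℤ_U. -/

section OpenSubspace

open Opposite Abelian

variable {X : TopCat.{u}} (U : Opens X)

/-- The inclusion of the poset of open subsets of an open subspace. -/
abbrev opensFunctor : Opens ((Opens.toTopCat X).obj U) ⥤ Opens X := U.isOpenEmbedding.functor

instance : (opensFunctor U).Full :=
  have : Mono U.inclusion' := (TopCat.mono_iff_injective _).2 U.isOpenEmbedding.injective
  IsOpenMap.functorFullOfMono _

instance : (opensFunctor U).IsContinuous (Opens.grothendieckTopology _)
    (Opens.grothendieckTopology X) :=
  U.isOpenEmbedding.functor_isContinuous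

/-- An open subset of `X` contained in `U` comes from an open subset of `U`. -/
lemma opensFunctor_obj_map {V : Opens X} (h : V ≤ U) :
    (opensFunctor U).obj ((Opens.map U.inclusion').obj V) = V := by
  refine Opens.ext (Set.image_preimage_eq_of_subset ?_)
  intro x hx
  exact ⟨⟨x, h hx⟩, rfl⟩

lemma opensFunctor_obj_le (W : Opens ((Opens.toTopCat X).obj U)) :
    (opensFunctor U).obj W ≤ U := by
  rintro _ ⟨x, _, rfl⟩
  exact x.2

lemma opensFunctor_obj_top : (opensFunctor U).obj ⊤ = U :=
  le_antisymm (opensFunctor_obj_le U ⊤) fun x hx => ⟨⟨x, hx⟩, trivial, rfl⟩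

instance : (opensFunctor U).IsCocontinuous (Opens.grothendieckTopology _)
    (Opens.grothendieckTopology X) where
  cover_lift {W} S hS := by
    intro x hx
    obtain ⟨V, i, hV, hxV⟩ := hS x.1 ⟨x, hx, rfl⟩
    have e : (opensFunctor U).obj ((Opens.map U.inclusion').obj V) = V :=
      opensFunctor_obj_map U (i.le.trans (opensFunctor_obj_le U W))
    have hle : (Opens.map U.inclusion').obj V ≤ W := by
      intro y hy
      obtain ⟨z, hz, hzy⟩ := i.le (show y.1 ∈ V from hy)
      have : z = y := Subtype.ext hzy
      exact this ▸ hz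
    refine ⟨(Opens.map U.inclusion').obj V, homOfLE hle, ?_, hxV⟩
    have : (opensFunctor U).map (homOfLE hle) = eqToHom e ≫ i := Subsingleton.elim _ _
    change S.arrows ((opensFunctor U).map (homOfLE hle))
    rw [this]
    exact S.downward_closed hV _

/-- The restriction of sheaves to an open subset. -/
abbrev restrictOpen : AbSheaf X ⥤ AbSheaf ((Opens.toTopCat X).obj U) :=
  (opensFunctor U).sheafPushforwardContinuous AddCommGrpCat.{u} (Opens.grothendieckTopology _)
    (Opens.grothendieckTopology X)

/-- The extension by zero of sheaves on an open subset. -/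
abbrev extendZero : AbSheaf ((Opens.toTopCat X).obj U) ⥤ AbSheaf X :=
  Functor.sheafPullbackConstruction.sheafPullback (opensFunctor U) AddCommGrpCat.{u}
    (Opens.grothendieckTopology _) (Opens.grothendieckTopology X)

/-- Extension by zero is left adjoint to restriction. -/
def extendZeroAdj : extendZero U ⊣ restrictOpen U :=
  Functor.sheafPullbackConstruction.sheafAdjunctionContinuous _ _ _ _

instance : (restrictOpen U).IsRightAdjoint := (extendZeroAdj U).isRightAdjoint

instance : (restrictOpen U).IsLeftAdjoint :=
  ((opensFunctor U).sheafAdjunctionCocontinuous AddCommGrpCat.{u} (Opens.grothendieckTopology _)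
    (Opens.grothendieckTopology X)).isLeftAdjoint

instance : PreservesFiniteLimits (restrictOpen U) :=
  have := (extendZeroAdj U).rightAdjoint_preservesLimits.{0, 0}
  ⟨fun _ => inferInstance⟩

instance : PreservesFiniteColimits (restrictOpen U) :=
  have := (Adjunction.ofIsLeftAdjoint (restrictOpen U)).leftAdjoint_preservesColimits.{0, 0}
  ⟨fun _ => inferInstance⟩

instance : (restrictOpen U).Additive := Functor.additive_of_preserves_binary_products _

/-- This makes restriction to `U` preserve injectives, as needed to compare Ext on X with cohomology
of `U`. -/
instance : (extendZero U).PreservesMonomorphisms where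
  preserves {F G} f _ := by
    have h₁ : Mono f.hom := inferInstanceAs (Mono ((sheafToPresheaf _ _).map f))
    have h₂ : Mono ((opensFunctor U).op.lan.map f.hom) := mono_lan_map _ (fun V => by
      by_cases hV : V.unop ≤ U
      · exact Or.inl ⟨op ((Opens.map U.inclusion').obj V.unop),
          ⟨eqToIso (congrArg op (opensFunctor_obj_map U hV))⟩⟩
      · exact Or.inr ⟨fun Y => hV (Y.hom.unop.le.trans (opensFunctor_obj_le U _))⟩) f.hom
    exact inferInstanceAs (Mono ((presheafToSheaf _ _).map ((opensFunctor U).op.lan.map f.hom)))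

instance : (restrictOpen U).PreservesInjectiveObjects :=
  Functor.preservesInjectiveObjects_of_adjunction_of_preservesMonomorphisms (extendZeroAdj U)

/-- The restriction of a constant sheaf to an open subset is constant. -/
def restrictOpenPiInv (G : AddCommGrpCat.{u}) :
    (restrictOpen U).obj ((piInv X).obj G) ≅ (piInv ((Opens.toTopCat X).obj U)).obj G :=
  (((opensFunctor U).pushforwardContinuousSheafificationCompatibility AddCommGrpCat.{u}
    (Opens.grothendieckTopology _) (Opens.grothendieckTopology X)).app
      ((Functor.const _).obj G)).symm

/-- The sheaf `ℤ_U` corepresents sections over `U`. -/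
def coyonedaIntOpen :
    coyoneda.obj (op (intOpen U)) ≅
      (sheafSections (Opens.grothendieckTopology X) AddCommGrpCat.{u}).obj (op U) ⋙
        forget AddCommGrpCat.{u} :=
  (sheafificationAdjunction (Opens.grothendieckTopology X)
    AddCommGrpCat.{u}).compCoyonedaIso.app (op (freeYoneda U)) ≪≫
    Functor.isoWhiskerLeft (sheafToPresheaf _ _) (coyonedaFreeYoneda U)

/-- The constant sheaf `ℤ` corepresents global sections. -/
def coyonedaPiInvInt (Y : TopCat.{u}) :
    coyoneda.obj (op ((piInv Y).obj (AddCommGrpCat.of (ULift.{u} ℤ)))) ≅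
      (sheafSections (Opens.grothendieckTopology Y) AddCommGrpCat.{u}).obj (op ⊤) ⋙
        forget AddCommGrpCat.{u} :=
  (constantSheafAdj (Opens.grothendieckTopology Y) AddCommGrpCat.{u}
    (isTerminalTop (α := Opens Y))).compCoyonedaIso.app (op _) ≪≫
    Functor.isoWhiskerLeft _ AddCommGrpCat.coyonedaObjIsoForget

/-- Morphisms from `ℤ_U` are global sections over `U`. -/
def coyonedaIntOpenIso :
    coyoneda.obj (op (intOpen U)) ≅ restrictOpen U ⋙ coyoneda.obj
      (op ((piInv ((Opens.toTopCat X).obj U)).obj (AddCommGrpCat.of (ULift.{u} ℤ)))) :=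
  coyonedaIntOpen U ≪≫
    Functor.isoWhiskerRight ((sheafSections _ _).mapIso (eqToIso (opensFunctor_obj_top U)).op)
      (forget _) ≪≫
    Functor.isoWhiskerLeft (restrictOpen U) (coyonedaPiInvInt _).symm

/-- Cohomological triviality in terms of `Ext` groups on the ambient space. -/
theorem cohTrivialOpen_iff :
    CohTrivialOpen U ↔ ∀ (i : ℕ) (G : AddCommGrpCat.{u}),
      Subsingleton (Ext.{u} (intOpen U) ((piInv X).obj G) (i + 1)) := by
  have h (i : ℕ) (G : AddCommGrpCat.{u}) :
      Subsingleton (Ext.{u} (intOpen U) ((piInv X).obj G) (i + 1)) ↔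
      Subsingleton (Sheaf.H.{u} ((piInv ((Opens.toTopCat X).obj U)).obj G) (i + 1)) := by
    refine (subsingleton_ext_iff (restrictOpen U) (coyonedaIntOpenIso U) i _).trans ?_
    exact ⟨fun _ => subsingleton_ext_of_iso (restrictOpenPiInv U G) _,
      fun _ => subsingleton_ext_of_iso (restrictOpenPiInv U G).symm _⟩
  constructor
  · intro hU i G
    exact (h i G).2 (hU (i + 1) i.succ_pos G)
  · intro hU i hi G
    obtain ⟨i, rfl⟩ := Nat.exists_eq_succ_of_ne_zero hi.ne'
    exact (h i G).1 (hU i G)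

end OpenSubspace

/-! ### The basis of connected, cohomologically trivial opens. -/

section Components

open Opposite Abelian

variable {X : TopCat.{u}}

/-- Sections over a disjoint union form a product, so a section over `V` extends by 0 on `W`. -/
lemma map_sup_left_surjective (F : AbSheaf X) {V W : Opens X} (h : V ⊓ W = ⊥) :
    Function.Surjective (F.obj.map (homOfLE (le_sup_left : V ≤ V ⊔ W)).op) := by
  have hl := TopCat.Sheaf.isProductOfDisjoint (F := F) V W h
  intro t
  refine ⟨hl.lift (BinaryFan.mk (𝟙 (F.obj.obj (op V))) 0) t, ?_⟩
  have := hl.fac (BinaryFan.mk (𝟙 (F.obj.obj (op V))) 0) ⟨WalkingPair.left⟩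
  exact ConcreteCategory.congr_hom this t

/-- The retraction corresponds to a section over `U` of ℤ_V that extends the tautological section
over `V`. -/
lemma nonempty_retract_intOpen {U V : Opens X} (i : V ⟶ U)
    (h : ∀ F : AbSheaf X, Function.Surjective (F.obj.map i.op)) :
    Nonempty (Retract (intOpen V) (intOpen U)) := by
  let e (W : Opens X) (F : AbSheaf X) : (intOpen W ⟶ F) ≃ F.obj.obj (op W) :=
    ((coyonedaIntOpen W).app F).toEquiv
  have he (W : Opens X) {F G : AbSheaf X} (f : F ⟶ G) (x : intOpen W ⟶ F) :
      e W G (x ≫ f) = f.hom.app (op W) (e W F x) :=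
    ConcreteCategory.congr_hom ((coyonedaIntOpen W).hom.naturality f) x
  obtain ⟨s, hs⟩ := h (intOpen V) (e V _ (𝟙 _))
  obtain ⟨r, rfl⟩ := (e U _).surjective s
  let ι : intOpen V ⟶ intOpen U := (e V _).symm ((intOpen U).obj.map i.op (e U _ (𝟙 _)))
  refine ⟨⟨ι, r, (e V _).injective ?_⟩⟩
  rw [he, Equiv.apply_symm_apply, ← hs]
  conv_rhs => rw [← Category.id_comp r, he]
  exact ConcreteCategory.congr_hom (r.hom.naturality i.op) _

lemma cohTrivialOpen_of_sup {V W : Opens X} (h : V ⊓ W = ⊥) (hU : CohTrivialOpen (V ⊔ W)) :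
    CohTrivialOpen V := by
  rw [cohTrivialOpen_iff] at hU ⊢
  intro i G
  have := hU i G
  obtain ⟨r⟩ := nonempty_retract_intOpen _ fun F => map_sup_left_surjective F h
  exact subsingleton_ext_of_retract r _ _

/-- The basic open subsets: connected and cohomologically trivial. -/
def BasicOpen (X : TopCat.{u}) : Type u :=
  {U : Opens X // IsConnected (U : Set X) ∧ CohTrivialOpen U}

/-- The open subset underlying a basic open subset. -/
def BasicOpen.toOpens (U : BasicOpen X) : Opens X := U.1

lemma exists_basicOpen [LocallyConnectedSpace X] (hX : LocallyCohTrivial X) {U : Opens X} {x : X}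
    (hx : x ∈ U) : ∃ V : BasicOpen X, x ∈ V.toOpens ∧ V.toOpens ≤ U := by
  obtain ⟨U', hU', hxU', hle⟩ := Opens.isBasis_iff_nbhd.1 hX hx
  let V : Opens X := ⟨connectedComponentIn U' x, U'.isOpen.connectedComponentIn⟩
  -- The union of the other components of `U'`, open because X is locally connected.
  let W : Opens X := ⟨⋃ y : {y // y ∈ U' ∧ y ∉ connectedComponentIn U' x},
    connectedComponentIn U' y.1, isOpen_iUnion fun y => U'.isOpen.connectedComponentIn⟩
  have hVW : V ⊓ W = ⊥ := by
    refine le_antisymm ?_ bot_le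
    rintro z ⟨hz, hz'⟩
    obtain ⟨⟨y, hy, hy'⟩, hz'⟩ := Set.mem_iUnion.1 hz'
    have h₁ := connectedComponentIn_eq hz
    have h₂ := connectedComponentIn_eq hz'
    exact hy' (h₁ ▸ h₂ ▸ mem_connectedComponentIn hy)
  have hU'' : V ⊔ W = U' := by
    refine le_antisymm (sup_le (connectedComponentIn_subset _ _) ?_) fun y hy => ?_
    · exact Set.iUnion_subset fun y => connectedComponentIn_subset _ _
    · by_cases h : y ∈ connectedComponentIn U' x
      · exact Or.inl h
      · exact Or.inr (Set.mem_iUnion.2 ⟨⟨y, hy, h⟩, mem_connectedComponentIn hy⟩)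
  refine ⟨⟨V, isConnected_connectedComponentIn_iff.2 hxU', cohTrivialOpen_of_sup hVW ?_⟩,
    mem_connectedComponentIn hxU', (connectedComponentIn_subset _ _).trans hle⟩
  rw [hU'']
  exact hU'

/-- The category of basic open subsets. -/
abbrev BasicOpens (X : TopCat.{u}) : Type u :=
  InducedCategory (Opens X) (BasicOpen.toOpens (X := X))

/-- The inclusion of the category of basic open subsets. -/
abbrev basicOpensFunctor (X : TopCat.{u}) : BasicOpens X ⥤ Opens X :=
  inducedFunctor BasicOpen.toOpens

lemma isCoverDense_basicOpensFunctor [LocallyConnectedSpace X] (hX : LocallyCohTrivial X) :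
    (basicOpensFunctor X).IsCoverDense (Opens.grothendieckTopology X) :=
  TopCat.Opens.coverDense_inducedFunctor (Opens.isBasis_iff_nbhd.2 fun {U} x hx => by
    obtain ⟨V, hV, hle⟩ := exists_basicOpen hX hx
    exact ⟨_, ⟨V, rfl⟩, hV, hle⟩)

end Components

/-! ### Injective resolutions placed in an arbitrary degree. -/

section Coresolution

open Opposite Abelian CochainComplex CochainComplex.HomComplex

universe v₁ u₁ w₁ t

variable {𝓑 : Type u₁} [Category.{v₁} 𝓑] [Abelian 𝓑] {κ : Type t} (T : κ → 𝓑)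

/-- The complex `J` is a K-injective coresolution of `M`, placed in degree `n`, which computes
trivial higher `Ext` groups from the objects `T k`. -/
structure IsAcyclicCoresolution {M : 𝓑} {n : ℤ} {J : CochainComplex 𝓑 ℤ} (j : M ⟶ J.X n) :
    Prop where
  isKInjective : J.IsKInjective
  comp_d : ∀ m, j ≫ J.d n m = 0
  mono : Mono j
  isZero : ∀ m, m < n → IsZero (J.X m)
  exists_eq_comp : ∀ (m : ℤ) (_ : n + 1 = m) (k : κ) (z : T k ⟶ J.X n), z ≫ J.d n m = 0 →
    ∃ x, z = x ≫ j
  exists_eq_d : ∀ (m₀ m₁ m₂ : ℤ) (_ : m₀ + 1 = m₁) (_ : m₁ + 1 = m₂) (_ : m₁ ≠ n) (k : κ)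
    (z : T k ⟶ J.X m₁), z ≫ J.d m₁ m₂ = 0 → ∃ x, z = x ≫ J.d m₀ m₁

variable {T}

lemma isAcyclicCoresolution_cochainComplex [HasExt.{w₁} 𝓑] {M : 𝓑} (R : InjectiveResolution M)
    (hT : ∀ k i, Subsingleton (Ext.{w₁} (T k) M (i + 1))) :
    IsAcyclicCoresolution T (n := 0) (J := R.cochainComplex)
      (R.ι.f 0 ≫ (R.cochainComplexXIso 0 0 rfl).inv) where
  isKInjective := isKInjective_of_injective _ 0
  comp_d m := by
    by_cases hm : 1 = m
    · subst hm
      rw [R.cochainComplex_d 0 1 0 1 rfl rfl, Category.assoc, Iso.inv_hom_id_assoc]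
      rw [← Category.assoc, R.ι_f_zero_comp_complex_d, zero_comp]
    · rw [R.cochainComplex.shape _ _ (by simpa using hm), comp_zero]
  mono := inferInstance
  isZero m hm := CochainComplex.isZero_of_isStrictlyGE _ 0 m hm
  exists_eq_comp m hm k z hz := by
    obtain rfl : m = 1 := by lia
    rw [R.cochainComplex_d 0 1 0 1 rfl rfl, ← Category.assoc, ← Category.assoc,
      Preadditive.IsIso.comp_right_eq_zero] at hz
    obtain ⟨l, hl⟩ := KernelFork.IsLimit.lift' R.isLimitKernelFork
      (z ≫ (R.cochainComplexXIso 0 0 rfl).hom) hz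
    refine ⟨l, ?_⟩
    exact ((Iso.eq_comp_inv _).2 hl.symm).trans (Category.assoc _ _ _)
  exists_eq_d m₀ m₁ m₂ h₁ h₂ h₀ k z hz := by
    -- Here `m₁` is non-zero: either it is positive, and exactness is the vanishing of Ext, or it is
    -- negative and the term is zero.
    by_cases hm : 0 ≤ m₀
    · obtain ⟨p, rfl⟩ := Int.eq_ofNat_of_zero_le hm
      obtain rfl : m₁ = (p + 1 : ℕ) := by push_cast; lia
      obtain rfl : m₂ = (p + 2 : ℕ) := by push_cast at h₂ ⊢; lia
      rw [R.cochainComplex_d _ _ (p + 1) (p + 2) rfl rfl, ← Category.assoc, ← Category.assoc,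
        Preadditive.IsIso.comp_right_eq_zero] at hz
      have := hT k p
      obtain ⟨g, hg⟩ := (R.extMk_eq_zero_iff _ (p + 2) rfl hz p rfl).1 (Subsingleton.elim _ _)
      refine ⟨g ≫ (R.cochainComplexXIso _ p rfl).inv, ?_⟩
      rw [R.cochainComplex_d _ _ p (p + 1) rfl rfl, Category.assoc, Iso.inv_hom_id_assoc,
        ← Category.assoc, hg]
      simp
    · exact ⟨0, (CochainComplex.isZero_of_isStrictlyGE R.cochainComplex 0 m₁ (by lia)).eq_of_tgt
        _ _⟩

lemma comp_shift_d (J : CochainComplex 𝓑 ℤ) {A : 𝓑} (n m m' : ℤ) (z : A ⟶ J.X (m + n)) :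
    CategoryStruct.comp (Z := (J⟦n⟧).X m') z ((J⟦n⟧).d m m') =
      n.negOnePow • (z ≫ J.d (m + n) (m' + n)) :=
  Linear.comp_units_smul _ _ _

lemma comp_d_eq_zero_of_shift {J : CochainComplex 𝓑 ℤ} {A : 𝓑} {n m m' : ℤ}
    {z : A ⟶ J.X (m + n)} (h : CategoryStruct.comp (Z := (J⟦n⟧).X m') z ((J⟦n⟧).d m m') = 0) :
    z ≫ J.d (m + n) (m' + n) = 0 :=
  (smul_eq_zero_iff_eq n.negOnePow).1 ((comp_shift_d J n m m' z).symm.trans h)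

/-- The shift changes the differential by a sign, which is a unit and is absorbed in the preimages.
-/
lemma IsAcyclicCoresolution.shift {M : 𝓑} {J : CochainComplex 𝓑 ℤ} {n : ℤ}
    {j : M ⟶ J.X (n + -n)} (h : IsAcyclicCoresolution T j) :
    IsAcyclicCoresolution T (n := n) (J := J⟦-n⟧) j where
  isKInjective := have := h.isKInjective; inferInstance
  comp_d m := (comp_shift_d J (-n) n m j).trans
    ((smul_eq_zero_iff_eq (-n).negOnePow).2 (h.comp_d (m + -n)))
  mono := h.mono
  isZero m hm := h.isZero _ (by lia)
  exists_eq_comp m hm k z hz :=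
    h.exists_eq_comp (m + -n) (by lia) k z (comp_d_eq_zero_of_shift hz)
  exists_eq_d m₀ m₁ m₂ h₁ h₂ h₀ k z hz := by
    obtain ⟨x, hx⟩ := h.exists_eq_d (m₀ + -n) (m₁ + -n) (m₂ + -n) (by lia) (by lia) (by lia) k z
      (comp_d_eq_zero_of_shift hz)
    refine ⟨((-n).negOnePow • x : T k ⟶ J.X (m₀ + -n)),
      hx.trans (Eq.trans ?_ (comp_shift_d J (-n) m₀ m₁ _).symm)⟩
    rw [Linear.units_smul_comp, smul_smul, Int.units_mul_self, one_smul]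

lemma exists_isAcyclicCoresolution [EnoughInjectives 𝓑] [HasExt.{w₁} 𝓑] {M : 𝓑}
    (hT : ∀ k i, Subsingleton (Ext.{w₁} (T k) M (i + 1))) (n : ℤ) :
    ∃ (J : CochainComplex 𝓑 ℤ) (j : M ⟶ J.X n), IsAcyclicCoresolution T j := by
  -- A term of the shifted complex in degree `n` is by definition the term in degree `n + -n`, which
  -- is only propositionally degree 0; hence the free variable `m`.
  have (m : ℤ) (hm : m = 0) :
      ∃ (J : CochainComplex 𝓑 ℤ) (j : M ⟶ J.X m), IsAcyclicCoresolution T j := by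
    subst hm
    exact ⟨_, _, isAcyclicCoresolution_cochainComplex (InjectiveResolution.of M) hT⟩
  obtain ⟨J, j, h⟩ := this (n + -n) (add_neg_cancel n)
  exact ⟨_, _, h.shift⟩

end Coresolution

/-! ### Products of coresolutions of the terms of a complex with zero differentials. -/

section Product

open Opposite Abelian CochainComplex CochainComplex.HomComplex

universe v₁ u₁ t

variable {𝓑 : Type u₁} [Category.{v₁} 𝓑] [Abelian 𝓑] [HasProductsOfShape ℤ 𝓑]
  (J : ℤ → CochainComplex 𝓑 ℤ)

lemma hom_ext_pi {A : 𝓑} {m : ℤ} {f g : A ⟶ (∏ᶜ J).X m}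
    (h : ∀ n, f ≫ (Pi.π J n).f m = g ≫ (Pi.π J n).f m) : f = g :=
  (isLimitOfPreserves (HomologicalComplex.eval 𝓑 _ m) (limit.isLimit (Discrete.functor J))).hom_ext
    fun n => h n.as

lemma exists_lift_pi {A : 𝓑} {m : ℤ} (f : ∀ n, A ⟶ (J n).X m) :
    ∃ g : A ⟶ (∏ᶜ J).X m, ∀ n, g ≫ (Pi.π J n).f m = f n := by
  let c : Cone (Discrete.functor J ⋙ HomologicalComplex.eval 𝓑 (ComplexShape.up ℤ) m) :=
    ⟨A, Discrete.natTrans fun n => f n.as⟩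
  have h := isLimitOfPreserves (HomologicalComplex.eval 𝓑 (ComplexShape.up ℤ) m)
    (limit.isLimit (Discrete.functor J))
  exact ⟨h.lift c, fun n => h.fac c ⟨n⟩⟩

/-- Products of K-injective complexes are K-injective. -/
lemma isKInjective_pi (hJ : ∀ n, (J n).IsKInjective) : (∏ᶜ J).IsKInjective where
  nonempty_homotopy_zero {K} f hK := by
    have (n : ℤ) : ∃ α : Cochain K (J n) (-1), δ (-1) 0 α = Cochain.ofHom (f ≫ Pi.π J n) := by
      have := hJ n
      exact IsKInjective.eq_δ_of_cocycle (Cocycle.ofHom (f ≫ Pi.π J n)) hK (-1) rfl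
    choose α hα using this
    choose β hβ using fun (p q : ℤ) (h : p + -1 = q) => exists_lift_pi J fun n => (α n).v p q h
    refine ⟨(Cochain.equivHomotopy _ _).symm ⟨Cochain.mk β, ?_⟩⟩
    rw [Cochain.ofHom_zero, add_zero]
    ext p
    refine hom_ext_pi J fun n => ?_
    have h := Cochain.congr_v (hα n) p p (add_zero p)
    rw [δ_v (-1) 0 rfl _ p p _ (p - 1) (p + 1) rfl rfl] at h ⊢
    simp only [Cochain.ofHom_v, HomologicalComplex.comp_f, Int.negOnePow_zero, one_smul,
      Cochain.mk_v, Preadditive.add_comp, Category.assoc] at h ⊢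
    rw [← h, ← hβ, ← hβ, ← (Pi.π J n).comm]
    simp

variable {J} {κ : Type t} {T : κ → 𝓑} {G : CochainComplex 𝓑 ℤ} {j : ∀ n, G.X n ⟶ (J n).X n}

/-- A complex with zero differential maps to a product of coresolutions of its terms. -/
lemma exists_hom_pi (hG : ∀ n m, G.d n m = 0) (hj : ∀ n m, j n ≫ (J n).d n m = 0) :
    ∃ q : G ⟶ ∏ᶜ J, (∀ n, q.f n ≫ (Pi.π J n).f n = j n) ∧
      ∀ m n, m ≠ n → q.f m ≫ (Pi.π J n).f m = 0 := by
  -- Projecting `G` to its term in degree `n` is a chain map only because the differentials vanish.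
  let q (n : ℤ) : G ⟶ J n :=
    HomologicalComplex.mkHomToSingle (j := n) (𝟙 (G.X n)) (fun i _ => by rw [hG, zero_comp]) ≫
      HomologicalComplex.mkHomFromSingle (j n) (fun m _ => hj n m)
  refine ⟨Pi.lift q, fun n => ?_, fun m n hmn => ?_⟩
  · rw [← HomologicalComplex.comp_f, Pi.lift_π, HomologicalComplex.comp_f,
      HomologicalComplex.mkHomToSingle_f, HomologicalComplex.mkHomFromSingle_f]
    simp
  · rw [← HomologicalComplex.comp_f, Pi.lift_π, HomologicalComplex.comp_f,
      (HomologicalComplex.isZero_single_obj_X _ n (G.X n) m hmn).eq_of_src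
        (HomologicalComplex.Hom.f _ m) 0, comp_zero]

/-- The cohomology of the product of coresolutions, seen from the objects `T k`. -/
lemma exists_comp_eq_add (hj : ∀ n, IsAcyclicCoresolution T (j n)) {q : G ⟶ ∏ᶜ J}
    (hq : ∀ n, q.f n ≫ (Pi.π J n).f n = j n) (hq' : ∀ m n, m ≠ n → q.f m ≫ (Pi.π J n).f m = 0)
    (m n n' : ℤ) (hm : m + 1 = n) (hn : n + 1 = n') (k : κ) (z : T k ⟶ (∏ᶜ J).X n)
    (hz : z ≫ (∏ᶜ J).d n n' = 0) :
    ∃ (x : T k ⟶ G.X n) (y : T k ⟶ (∏ᶜ J).X m), x ≫ q.f n = z + y ≫ (∏ᶜ J).d m n := by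
  have hz' (l : ℤ) : (z ≫ (Pi.π J l).f n) ≫ (J l).d n n' = 0 := by
    rw [Category.assoc, (Pi.π J l).comm, ← Category.assoc, hz, zero_comp]
  obtain ⟨x, hx⟩ := (hj n).exists_eq_comp n' hn k _ (hz' n)
  have hy (l : ℤ) : ∃ y : T k ⟶ (J l).X m,
      x ≫ q.f n ≫ (Pi.π J l).f n = z ≫ (Pi.π J l).f n + y ≫ (J l).d m n := by
    -- In degree `n` only the factor `J n` can have cohomology seen by `T k`, and it comes from `G`;
    -- the other components are boundaries.
    by_cases hl : n = l
    · subst hl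
      exact ⟨0, by rw [hq, hx, zero_comp, add_zero]⟩
    · obtain ⟨y, hy⟩ := (hj l).exists_eq_d m n n' hm hn hl k _ (hz' l)
      exact ⟨-y, by rw [hq' n l hl, comp_zero, hy, Preadditive.neg_comp, add_neg_cancel]⟩
  choose y hy using hy
  obtain ⟨y', hy'⟩ := exists_lift_pi J y
  refine ⟨x, y', hom_ext_pi J fun l => ?_⟩
  rw [Preadditive.add_comp, Category.assoc, hy, Category.assoc, ← (Pi.π J l).comm,
    ← Category.assoc y', hy']

/-- The factor `J n` is zero in degree `m`, so the boundary has no component there, while `j n` is a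
monomorphism. -/
lemma eq_zero_of_comp_eq (hj : ∀ n, IsAcyclicCoresolution T (j n)) {q : G ⟶ ∏ᶜ J}
    (hq : ∀ n, q.f n ≫ (Pi.π J n).f n = j n) (m n : ℤ) (hm : m + 1 = n) {A : 𝓑}
    (z : A ⟶ G.X n) (y : A ⟶ (∏ᶜ J).X m) (h : z ≫ q.f n = y ≫ (∏ᶜ J).d m n) : z = 0 := by
  have := (hj n).mono
  rw [← cancel_mono (j n), zero_comp, ← hq, ← Category.assoc, h, Category.assoc,
    ← (Pi.π J n).comm, ((hj n).isZero m (by lia)).eq_of_tgt ((Pi.π J n).f m) 0, zero_comp,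
    comp_zero]

end Product

/-! ### Testing quasi-isomorphisms of presheaves by maps from sheaves. -/

section QuasiIso

open CochainComplex

universe v v₁ u₁

variable {𝓐 : Type u₁} {𝓑 : Type v₁} [Category.{v} 𝓐] [Category.{v} 𝓑] [Abelian 𝓐] [Abelian 𝓑]
  {a : 𝓐 ⥤ 𝓑} {ι : 𝓑 ⥤ 𝓐} [ι.Additive] {κ : Type v} {P : κ → 𝓐}
  [IsCompactProjectiveFamily P]

/-- A criterion for the image under a right adjoint functor of a morphism from a complex with zero
differentials to be a quasi-isomorphism. -/
lemma quasiIso_map_of_family (adj : a ⊣ ι) {G I : CochainComplex 𝓑 ℤ} (q : G ⟶ I)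
    (hG : ∀ n m, G.d n m = 0)
    (h₁ : ∀ (m n n' : ℤ) (_ : m + 1 = n) (_ : n + 1 = n') (k : κ) (z : a.obj (P k) ⟶ I.X n),
      z ≫ I.d n n' = 0 → ∃ (x : a.obj (P k) ⟶ G.X n) (y : a.obj (P k) ⟶ I.X m),
        x ≫ q.f n = z + y ≫ I.d m n)
    (h₂ : ∀ (m n : ℤ) (_ : m + 1 = n) (k : κ) (z : a.obj (P k) ⟶ G.X n)
      (y : a.obj (P k) ⟶ I.X m), z ≫ q.f n = y ≫ I.d m n → z = 0) :
    QuasiIso ((ι.mapHomologicalComplex (ComplexShape.up ℤ)).map q) := by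
  have hadd (k : κ) {B : 𝓑} (f g : a.obj (P k) ⟶ B) :
      adj.homEquiv _ _ (f + g) = adj.homEquiv _ _ f + adj.homEquiv _ _ g := by
    simp [Adjunction.homEquiv_unit]
  have hzero (k : κ) {B : 𝓑} : adj.homEquiv (P k) B 0 = 0 := by
    simp [Adjunction.homEquiv_unit]
  refine quasiIso_of_family (P := P) _ ?_ ?_
  · intro m n n' hm hn k z hz
    obtain ⟨z, rfl⟩ := (adj.homEquiv _ _).surjective z
    change adj.homEquiv _ _ z ≫ ι.map (I.d n n') = 0 at hz
    rw [← adj.homEquiv_naturality_right, ← hzero, Equiv.apply_eq_iff_eq] at hz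
    obtain ⟨x, y, h⟩ := h₁ m n n' hm hn k z hz
    refine ⟨adj.homEquiv _ _ x, adj.homEquiv _ _ y, ?_, ?_⟩
    · change adj.homEquiv _ _ x ≫ ι.map (G.d n n') = 0
      rw [hG, ι.map_zero, comp_zero]
    · change adj.homEquiv _ _ x ≫ ι.map (q.f n) =
        adj.homEquiv _ _ z + adj.homEquiv _ _ y ≫ ι.map (I.d m n)
      rw [← adj.homEquiv_naturality_right, ← adj.homEquiv_naturality_right, ← hadd, h]
  · intro m n n' hm hn k z y hz h
    obtain ⟨z, rfl⟩ := (adj.homEquiv _ _).surjective z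
    obtain ⟨y, rfl⟩ := (adj.homEquiv _ _).surjective y
    change adj.homEquiv _ _ z ≫ ι.map (q.f n) = adj.homEquiv _ _ y ≫ ι.map (I.d m n) at h
    rw [← adj.homEquiv_naturality_right, ← adj.homEquiv_naturality_right,
      Equiv.apply_eq_iff_eq] at h
    refine ⟨0, ?_⟩
    rw [zero_comp, h₂ m n hm k z y h]
    exact (hzero k).symm

end QuasiIso

/-! ### The resolution functor, existence of 𝕃, and acyclicity. -/

section Resolution

open Opposite Abelian

variable {X : TopCat.{u}} {B : Type u} [SmallCategory B] (F : B ⥤ Opens X) [F.Full] [F.Faithful]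
  [F.IsCoverDense (Opens.grothendieckTopology X)]

/-- The sheaf on `X` associated to a free presheaf on a basis. -/
def sheafOfBasisFreeYoneda (b : B) : (sheafOfBasis F).obj (freeYoneda b) ≅ intOpen (F.obj b) :=
  (Coyoneda.fullyFaithful.preimageIso (coyonedaIntOpen (F.obj b) ≪≫
    (Functor.isoWhiskerLeft (restrictToBasis F) (coyonedaFreeYoneda b)).symm ≪≫
    ((basisAdjunction F).compCoyonedaIso.app (op (freeYoneda b))).symm)).unop

/-- The functorial resolution of complexes of sheaves by direct sums of the sheaves `ℤ_U`, with
`U` in the given basis. -/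
def resolution : SheafComplex X ⥤ SheafComplex X :=
  (restrictToBasis F).mapHomologicalComplex (ComplexShape.up ℤ) ⋙
    semifree (fun b : B => freeYoneda b) ⋙
    (sheafOfBasis F).mapHomologicalComplex (ComplexShape.up ℤ)

/-- The augmentation of the resolution. -/
def resolutionπ : resolution F ⟶ 𝟭 (SheafComplex X) :=
  Functor.whiskerLeft _ (Functor.whiskerRight (semifreeπ _) _) ≫
    (mapComplexAdjunction (basisAdjunction F)).counit

instance isIso_counit (K : SheafComplex X) :
    IsIso ((mapComplexAdjunction (basisAdjunction F)).counit.app K) := by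
  have (n : ℤ) : IsIso (((mapComplexAdjunction (basisAdjunction F)).counit.app K).f n) :=
    inferInstanceAs (IsIso ((basisAdjunction F).counit.app (K.X n)))
  exact HomologicalComplex.Hom.isIso_of_components _

instance quasiIso_resolutionπ (K : SheafComplex X) : QuasiIso ((resolutionπ F).app K) := by
  let s := (semifreeπ (fun b : B => freeYoneda b)).app
    (((restrictToBasis F).mapHomologicalComplex (ComplexShape.up ℤ)).obj K)
  have : QuasiIso (((sheafOfBasis F).mapHomologicalComplex (ComplexShape.up ℤ)).map s) :=
    inferInstance
  exact inferInstanceAs (QuasiIso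
    (((sheafOfBasis F).mapHomologicalComplex (ComplexShape.up ℤ)).map s ≫
      (mapComplexAdjunction (basisAdjunction F)).counit.app K))

lemma isSumOfIntOpens_resolution (hF : ∀ b, IsConnected (F.obj b : Set X) ∧
    CohTrivialOpen (F.obj b)) (K : SheafComplex X) (n : ℤ) :
    IsSumOfIntOpens (((resolution F).obj K).X n) := by
  obtain ⟨κ, i, ⟨e⟩⟩ := exists_semifree_X_iso (P := fun b : B => freeYoneda b)
    (((restrictToBasis F).mapHomologicalComplex (ComplexShape.up ℤ)).obj K) n
  have := (basisAdjunction F).leftAdjoint_preservesColimits.{u, u}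
  refine ⟨κ, fun k => F.obj (i k), fun k => hF _, ⟨(sheafOfBasis F).mapIso e ≪≫
    PreservesCoproduct.iso (sheafOfBasis F) (fun k => freeYoneda (i k)) ≪≫
    Sigma.mapIso fun k => sheafOfBasisFreeYoneda F (i k)⟩⟩

/-- Restriction to presheaves is not right exact in general, but on constant sheaves it yields
constant presheaves. -/
lemma exact_piInv_comp_restrictToBasis (hF : ∀ b, IsConnected (F.obj b : Set X)) :
    PreservesFiniteLimits (piInv X ⋙ restrictToBasis F) ∧
      PreservesFiniteColimits (piInv X ⋙ restrictToBasis F) := by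
  have h₁ : PreservesFiniteLimits (Functor.const Bᵒᵖ (C := AddCommGrpCat.{u})) :=
    ⟨fun J _ _ => inferInstance⟩
  have h₂ : PreservesFiniteColimits (Functor.const Bᵒᵖ (C := AddCommGrpCat.{u})) :=
    ⟨fun J _ _ => inferInstance⟩
  exact ⟨preservesFiniteLimits_of_natIso (piInvCompRestrictToBasis F hF),
    preservesFiniteColimits_of_natIso (piInvCompRestrictToBasis F hF)⟩

/-- For a complex `H` of abelian groups with zero differentials, the complex of constant sheaves
`H` has a K-injective resolution which remains a resolution on the given basis. -/
lemma exists_isKInjective_resolution (hF : ∀ b, IsConnected (F.obj b : Set X) ∧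
    CohTrivialOpen (F.obj b)) (H : CochainComplex AddCommGrpCat.{u} ℤ) (hH : ∀ i j, H.d i j = 0) :
    ∃ (I : SheafComplex X)
      (q : ((piInv X).mapHomologicalComplex (ComplexShape.up ℤ)).obj H ⟶ I),
      I.IsKInjective ∧ QuasiIso q ∧
        QuasiIso (((restrictToBasis F).mapHomologicalComplex (ComplexShape.up ℤ)).map q) := by
  let T (b : B) : AbSheaf X := (sheafOfBasis F).obj (freeYoneda b)
  have hT (M : AddCommGrpCat.{u}) (b : B) (i : ℕ) :
      Subsingleton (Ext.{u} (T b) ((piInv X).obj M) (i + 1)) := by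
    have := (cohTrivialOpen_iff _).1 (hF b).2 i M
    exact subsingleton_ext_of_retract (Retract.ofIso (sheafOfBasisFreeYoneda F b)) _ _
  choose J j hj using fun n : ℤ => exists_isAcyclicCoresolution (hT (H.X n)) n
  let G := ((piInv X).mapHomologicalComplex (ComplexShape.up ℤ)).obj H
  have hG (n m : ℤ) : G.d n m = 0 := by
    change (piInv X).map (H.d n m) = 0
    rw [hH, Functor.map_zero]
  have : HasProductsOfShape ℤ (AbSheaf X) := inferInstance
  obtain ⟨q, hq, hq'⟩ := exists_hom_pi (J := J) (G := G) (j := j) hG fun n m => (hj n).comp_d m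
  have h : QuasiIso (((restrictToBasis F).mapHomologicalComplex (ComplexShape.up ℤ)).map q) :=
    quasiIso_map_of_family (P := fun b : B => freeYoneda b) (basisAdjunction F) q hG
      (fun m n n' hm hn k z hz => exists_comp_eq_add hj hq hq' m n n' hm hn k z hz)
      (fun m n hm k z y h => eq_zero_of_comp_eq hj hq m n hm z y h)
  refine ⟨∏ᶜ J, q, isKInjective_pi J fun n => (hj n).isKInjective, ?_, h⟩
  -- Sheafifying the quasi-isomorphism of presheaves gives back `q`, up to the invertible counit.
  have h' := (mapComplexAdjunction (basisAdjunction F)).counit.naturality q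
  have h₁ : QuasiIso (((sheafOfBasis F).mapHomologicalComplex (ComplexShape.up ℤ)).map
    (((restrictToBasis F).mapHomologicalComplex (ComplexShape.up ℤ)).map q)) := inferInstance
  have h₂ : QuasiIso ((mapComplexAdjunction (basisAdjunction F)).counit.app G ≫ q) := by
    rw [← Functor.id_map q, ← h']
    exact inferInstanceAs (QuasiIso (((sheafOfBasis F).mapHomologicalComplex
      (ComplexShape.up ℤ)).map (((restrictToBasis F).mapHomologicalComplex
      (ComplexShape.up ℤ)).map q) ≫
      (mapComplexAdjunction (basisAdjunction F)).counit.app (∏ᶜ J)))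
  exact quasiIso_of_comp_left ((mapComplexAdjunction (basisAdjunction F)).counit.app G) q

variable [HasDerivedCategory.{w} (AbSheaf X)] [HasDerivedCategory.{w'} AddCommGrpCat.{u}]

/-- Morphisms in the derived category from the cosections of a resolution. -/
theorem bijective_derivedHomMap_resolution [(piInv X).IsRightAdjoint]
    (hF : ∀ b, IsConnected (F.obj b : Set X) ∧ CohTrivialOpen (F.obj b)) (K : SheafComplex X)
    (Z : DerivedCategory AddCommGrpCat.{u}) :
    Function.Bijective (derivedHomMap.{u, u, u + 1, u + 1, w, w'} (cosectionsAdj X)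
      ((resolution F).obj K) Z) := by
  obtain ⟨H, hH, ⟨e⟩⟩ := exists_iso_Q_of_zero_d Z
  refine bijective_derivedHomMap_of_iso _ _ e ?_
  obtain ⟨I, q, _, _, _⟩ := exists_isKInjective_resolution F hF H hH
  obtain ⟨_, _⟩ := exact_piInv_comp_restrictToBasis F fun b => (hF b).1
  let S := (semifree (fun b : B => freeYoneda b)).obj
    (((restrictToBasis F).mapHomologicalComplex (ComplexShape.up ℤ)).obj K)
  have hS : S.IsKProjective := inferInstance
  -- Apply the composite adjunction: its right adjoint, sending a group to its constant presheaf on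
  -- the basis, is exact.
  have hL : CochainComplex.IsKProjective (((sheafOfBasis F ⋙ cosections X).mapHomologicalComplex
      (ComplexShape.up ℤ)).obj S) :=
    isKProjective_of_adjunction ((basisAdjunction F).comp (cosectionsAdj X))
  have : CochainComplex.IsKProjective (((cosections X).mapHomologicalComplex
      (ComplexShape.up ℤ)).obj (((sheafOfBasis F).mapHomologicalComplex
      (ComplexShape.up ℤ)).obj S)) := hL
  exact bijective_derivedHomMap (cosectionsAdj X) (basisAdjunction F) (K := S) q

/-- Each object of D(X) is isomorphic to a resolution, whose cosections corepresent the required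
functor; a left adjoint defined on every object is a functor. -/
lemma isRightAdjoint_piInvD
    (hF : ∀ b, IsConnected (F.obj b : Set X) ∧ CohTrivialOpen (F.obj b)) :
    (piInvD.{w, w'} X).IsRightAdjoint := by
  have := isRightAdjoint_piInv F fun b => (hF b).1
  refine Functor.isRightAdjoint_of_leftAdjointObjIsDefined_eq_top (funext fun Y => ?_)
  simp only [Pi.top_apply, Prop.top_eq_true, eq_iff_iff, iff_true]
  rw [Functor.leftAdjointObjIsDefined_iff]
  let K := DerivedCategory.Q.objPreimage Y
  let e : DerivedCategory.Q.obj ((resolution F).obj K) ≅ Y :=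
    asIso (DerivedCategory.Q.map ((resolutionπ F).app K)) ≪≫ DerivedCategory.Q.objObjPreimageIso Y
  exact (Functor.CorepresentableBy.isCorepresentable (X := DerivedCategory.Q.obj
      ((cosectionsComplex X).obj ((resolution F).obj K)))
    { homEquiv := fun {Z} => (Equiv.ofBijective _
        (bijective_derivedHomMap_resolution F hF K Z)).trans e.homFromEquiv
      homEquiv_comp := fun {Z Z'} g f => by
        simp [derivedHomMap] })

/-- Precomposition with the comparison morphism becomes, by adjunction, the bijection of
`bijective_derivedHomMap_resolution`; the Yoneda lemma concludes. -/
lemma isLAcyclic_resolution [(piInvD.{w, w'} X).IsRightAdjoint] [(piInv X).IsRightAdjoint]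
    (hF : ∀ b, IsConnected (F.obj b : Set X) ∧ CohTrivialOpen (F.obj b)) (K : SheafComplex X) :
    IsLAcyclic.{w, w'} X ((resolution F).obj K) := by
  let c := (comparison.{w, w'} X).app ((resolution F).obj K)
  have key (Z : DerivedCategory AddCommGrpCat.{u}) (g : DerivedCategory.Q.obj
      ((cosectionsComplex X).obj ((resolution F).obj K)) ⟶ Z) :
      (homologyDAdj.{w, w'} X).homEquiv _ _ (c ≫ g) =
        derivedHomMap.{u, u, u + 1, u + 1, w, w'} (cosectionsAdj X) _ Z g := by
    refine ((homologyDAdj.{w, w'} X).homEquiv_naturality_right c g).trans ?_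
    exact congrArg (fun f => f ≫ (piInvD.{w, w'} X).map g) (Equiv.apply_symm_apply _ _)
  have hc (Z : DerivedCategory AddCommGrpCat.{u}) :
      Function.Bijective (fun g : DerivedCategory.Q.obj
        ((cosectionsComplex X).obj ((resolution F).obj K)) ⟶ Z => c ≫ g) := by
    rw [← Function.Bijective.of_comp_iff' ((homologyDAdj.{w, w'} X).homEquiv _ _).bijective]
    convert bijective_derivedHomMap_resolution F hF K Z using 1
    exact funext (key Z)
  exact (isIso_iff_coyoneda_map_bijective c).2 fun Z => hc Z

end Resolution

/-! ### Derived functors from functorial acyclic resolutions. -/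

section KanExtension

universe v₁ v₂ v₃ u₁ u₂ u₃

variable {𝓒 : Type u₁} {𝓓 : Type u₂} {𝓔 : Type u₃} [Category.{v₁} 𝓒] [Category.{v₂} 𝓓]
  [Category.{v₃} 𝓔] {Q : 𝓒 ⥤ 𝓓} {H : 𝓓 ⥤ 𝓔} {Φ : 𝓒 ⥤ 𝓔} {C : 𝓒 ⥤ 𝓒}

/-- The values of a functor on the localized category, in terms of a resolution functor. -/
def resolutionIso (p : C ⟶ 𝟭 𝓒) [∀ K, IsIso (Q.map (p.app K))] (G : 𝓓 ⥤ 𝓔) :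
    Q ⋙ G ≅ C ⋙ Q ⋙ G :=
  Iso.symm (NatIso.ofComponents (F := C ⋙ Q ⋙ G) (G := Q ⋙ G)
    (fun K => G.mapIso (asIso (Q.map (p.app K)))) (fun {K K'} f => by
      simp only [Functor.comp_map, Functor.mapIso_hom, asIso_hom, ← Functor.map_comp]
      exact congrArg (fun g => G.map (Q.map g)) (p.naturality f)))

/-- The left derived functor is computed by acyclic resolutions. -/
def isoOfResolution (α : Q ⋙ H ⟶ Φ) (p : C ⟶ 𝟭 𝓒) [∀ K, IsIso (Q.map (p.app K))]
    [∀ K, IsIso (α.app (C.obj K))] : Q ⋙ H ≅ C ⋙ Φ :=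
  resolutionIso p H ≪≫ NatIso.ofComponents (F := C ⋙ Q ⋙ H) (G := C ⋙ Φ)
    (fun K => asIso (α.app (C.obj K))) (fun f => α.naturality (C.map f))

lemma map_comp_isoOfResolution_hom_app (α : Q ⋙ H ⟶ Φ) (p : C ⟶ 𝟭 𝓒)
    [∀ K, IsIso (Q.map (p.app K))] [∀ K, IsIso (α.app (C.obj K))] (K : 𝓒) :
    H.map (Q.map (p.app K)) ≫ (isoOfResolution α p).hom.app K = α.app (C.obj K) := by
  simp only [isoOfResolution, resolutionIso, Iso.trans_hom, NatTrans.comp_app, Iso.symm_hom,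
    NatIso.ofComponents_inv_app, Functor.mapIso_inv, asIso_inv]
  rw [← Category.assoc, ← Functor.map_comp, IsIso.hom_inv_id, CategoryTheory.Functor.map_id,
    Category.id_comp]
  rfl

/-- A functor with acyclic resolutions has a left derived functor. -/
theorem isRightKanExtension_of_resolution (α : Q ⋙ H ⟶ Φ) (p : C ⟶ 𝟭 𝓒)
    [∀ K, IsIso (Q.map (p.app K))] [∀ K, IsIso (α.app (C.obj K))] (W : MorphismProperty 𝓒)
    [Q.IsLocalization W] :
    H.IsRightKanExtension α := by
  -- The only possible choice: G K ≅ G (C K) → Φ (C K) ≅ H (C K) ≅ H K, with the middle arrow `β`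
  -- and the next isomorphism the inverse of `α`.
  let δ (G : 𝓓 ⥤ 𝓔) (β : Q ⋙ G ⟶ Φ) : G ⟶ H :=
    Localization.liftNatTrans Q W (Q ⋙ G) (Q ⋙ H) G H
      ((resolutionIso p G).hom ≫ Functor.whiskerLeft C β ≫ (isoOfResolution α p).inv)
  have hδ (G : 𝓓 ⥤ 𝓔) (β : Q ⋙ G ⟶ Φ) (K : 𝓒) : G.map (Q.map (p.app K)) ≫ (δ G β).app (Q.obj K) =
      β.app (C.obj K) ≫ inv (α.app (C.obj K)) ≫ H.map (Q.map (p.app K)) := by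
    simp [δ, resolutionIso, isoOfResolution]
    rfl
  refine ⟨⟨IsTerminal.ofUniqueHom
    (fun Y => CostructuredArrow.homMk (δ Y.left Y.hom) ?_) (fun Y m => ?_)⟩⟩
  · ext K
    change (δ Y.left Y.hom).app (Q.obj K) ≫ α.app K = Y.hom.app K
    rw [← cancel_epi (Y.left.map (Q.map (p.app K))), ← Category.assoc, hδ]
    have h₁ := α.naturality (p.app K)
    have h₂ := Y.hom.naturality (p.app K)
    simp only [Functor.comp_map, Functor.id_obj] at h₁
    rw [Category.assoc, Category.assoc, h₁, IsIso.inv_hom_id_assoc]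
    exact h₂.symm
  · refine CostructuredArrow.hom_ext _ _ (Localization.natTrans_ext Q W fun K => ?_)
    let n : Y.left ⟶ H := m.left
    have hn (K : 𝓒) : n.app (Q.obj K) ≫ α.app K = Y.hom.app K := congr_app (CostructuredArrow.w m) K
    refine (cancel_epi (Y.left.map (Q.map (p.app K)))).1 (Eq.trans ?_ (hδ Y.left Y.hom K).symm)
    rw [← hn, Category.assoc, IsIso.hom_inv_id_assoc]
    exact n.naturality (Q.map (p.app K))

end KanExtension

end SheafHomology

end

/-! ### The theorem, for the basis of all connected, cohomologically trivial opens. -/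

theorem mainTheorem6 (X : TopCat.{u}) [LocallyConnectedSpace X]
    (hX : SheafHomology.LocallyCohTrivial X)
    [HasDerivedCategory.{w} (SheafHomology.AbSheaf X)]
    [HasDerivedCategory.{w'} AddCommGrpCat.{u}] :
    -- the left adjoints `L(X, -)` and `𝕃(X, -)` exist
    ∃ (_ : (SheafHomology.piInv X).IsRightAdjoint)
      (_ : (SheafHomology.piInvD.{w, w'} X).IsRightAdjoint),
      -- functorial resolution `p : C F ⟶ F`
      (∃ (C : SheafHomology.SheafComplex X ⥤ SheafHomology.SheafComplex X)
        (p : C ⟶ 𝟭 (SheafHomology.SheafComplex X)),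
        (∀ F, QuasiIso (p.app F)) ∧
        (∀ F, SheafHomology.IsLAcyclic.{w, w'} X (C.obj F)) ∧
        (∀ F n, SheafHomology.IsSumOfIntOpens ((C.obj F).X n)) ∧
        -- `𝕃(X, F) ≅ L(X, C F)`, naturally in `F` and compatibly with `𝕃(X, C F) ⟶ L(X, C F)`
        ∃ e : DerivedCategory.Q ⋙ SheafHomology.homologyD.{w, w'} X ≅
            C ⋙ SheafHomology.cosectionsComplex X ⋙ DerivedCategory.Q,
          ∀ F, (SheafHomology.homologyD.{w, w'} X).map (DerivedCategory.Q.map (p.app F)) ≫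
            e.hom.app F = (SheafHomology.comparison.{w, w'} X).app (C.obj F)) ∧
      -- `𝕃(X, -)` is the left derived functor of `L(X, -)`
      (SheafHomology.homologyD.{w, w'} X).IsLeftDerivedFunctor
        (SheafHomology.comparison.{w, w'} X)
        (HomologicalComplex.quasiIso (SheafHomology.AbSheaf X) (ComplexShape.up ℤ)) := by
  have := SheafHomology.isCoverDense_basicOpensFunctor hX
  have hF (b : SheafHomology.BasicOpens X) :
      IsConnected ((SheafHomology.basicOpensFunctor X).obj b : Set X) ∧
        SheafHomology.CohTrivialOpen ((SheafHomology.basicOpensFunctor X).obj b) := b.2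
  have h₁ := SheafHomology.isRightAdjoint_piInv _ fun b => (hF b).1
  have h₂ := SheafHomology.isRightAdjoint_piInvD.{w, w'} _ hF
  let C := SheafHomology.resolution (SheafHomology.basicOpensFunctor X)
  let p : C ⟶ 𝟭 _ := SheafHomology.resolutionπ (SheafHomology.basicOpensFunctor X)
  have hp (K : SheafHomology.SheafComplex X) : QuasiIso (p.app K) :=
    SheafHomology.quasiIso_resolutionπ _ K
  have hpQ (K : SheafHomology.SheafComplex X) :
      IsIso ((DerivedCategory.Q (C := SheafHomology.AbSheaf X)).map (p.app K)) := inferInstance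
  have hC (K : SheafHomology.SheafComplex X) :
      IsIso ((SheafHomology.comparison.{w, w'} X).app (C.obj K)) :=
    SheafHomology.isLAcyclic_resolution _ hF K
  exact ⟨h₁, h₂, ⟨C, p, hp, hC,
    fun K n => SheafHomology.isSumOfIntOpens_resolution _ hF K n,
    SheafHomology.isoOfResolution (SheafHomology.comparison X) p,
    SheafHomology.map_comp_isoOfResolution_hom_app _ p⟩,
    ⟨SheafHomology.isRightKanExtension_of_resolution (SheafHomology.comparison X) p
      (HomologicalComplex.quasiIso (SheafHomology.AbSheaf X) (ComplexShape.up ℤ))⟩⟩
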